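/- Let $M$ be a smooth (Hausdorff, second countable) $n$-dimensional Riemannian manifold without boundary, with metric $\langle\cdot,\cdot\rangle$, Levi-Civita connection $\nabla$ and Riemannian volume measure $d\mathcal H^n$, and assume that $M$ is complete. For a smooth function $u$ let $\nabla u$ be its gradient, $\nabla^2u$ its covariant Hessian and $\Delta u=\mathrm{div}\,\nabla u$. Let $H^2(M)$ be the completion of the space of smooth real-valued functions $u$ on $M$ with $\|u\|_{H^2}^2=\int_M(|u|^2+|\nabla u|^2+|\nabla^2u|^2)\,d\mathcal H^n<\infty$ with respect to this norm, regarded as a space of $L^2$ functions; for $f\in H^2(M)$, $\nabla f$ and $\Delta f$ are the $L^2$ limits of $\nabla u_j$ and $\Delta u_j$ along smooth functions $u_j$ that converge to $f$ in $H^2(M)$. Let $X$ be a Killing vector field on $M$, that is, a smooth vector field with $\langle\nabla_YX,Z\rangle+\langle Y,\nabla_ZX\rangle=0$ on $M$ for all smooth vector fields $Y,Z$, and assume that $X$ is bounded: $\sup_M|X|<\infty$. (Completeness of $M$ and boundedness of $X$ are automatic if $M$ is compact.) Then for all real-valued $f,g\in H^2(M)$ the function $(\Delta f)\langle\nabla g,X\rangle+(\Delta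 g)\langle\nabla f,X\rangle$ is integrable on $M$ and $$\int_M\bigl\{(\Delta f)\langle\nabla g,X\rangle+(\Delta g)\langle\nabla f,X\rangle\bigr\}\,d\mathcal H^n=0 .$$ -/

import Mathlib

open Bundle MeasureTheory VectorField Filter
open scoped Manifold ContDiff Topology ENNReal

set_option linter.unusedSectionVars false

noncomputable section

namespace RiemCalc

variable {n : ℕ} {M : Type*} [TopologicalSpace M]
  [ChartedSpace (EuclideanSpace ℝ (Fin n)) M] [IsManifold (𝓡 n) ∞ M]
  [RiemannianBundle (fun x : M ↦ TangentSpace (𝓡 n) x)]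

/-- The vector field `X`, as a section of the tangent bundle, is differentiable at `x`. -/
abbrev DiffFieldAt (X : Π x : M, TangentSpace (𝓡 n) x) (x : M) : Prop :=
  MDifferentiableAt (𝓡 n) (𝓡 n).tangent (fun y ↦ (⟨y, X y⟩ : TangentBundle (𝓡 n) M)) x

/-- The pointwise scalar product `⟨X, Y⟩` of two vector fields. -/
def ip (X Y : Π x : M, TangentSpace (𝓡 n) x) (x : M) : ℝ := inner ℝ (X x) (Y x)

/-- The right-hand side of the Koszul formula for `⟨∇_X Y, Z⟩`. -/
def koszul (Y X Z : Π x : M, TangentSpace (𝓡 n) x) (x : M) : ℝ :=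
  (1 / 2 : ℝ) * (mvfderiv (𝓡 n) (ip Y Z) x (X x) + mvfderiv (𝓡 n) (ip X Z) x (Y x)
    - mvfderiv (𝓡 n) (ip X Y) x (Z x)
    + ip (mlieBracket (𝓡 n) X Y) Z x - ip (mlieBracket (𝓡 n) X Z) Y x
    - ip (mlieBracket (𝓡 n) Y Z) X x)

variable [IsContMDiffRiemannianBundle (𝓡 n) ∞ (EuclideanSpace ℝ (Fin n))
    (fun x : M ↦ TangentSpace (𝓡 n) x)]

theorem ip_comm (X Y : Π x : M, TangentSpace (𝓡 n) x) : ip X Y = ip Y X := by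
  funext x; exact real_inner_comm _ _

theorem ip_add_left (X X' Y : Π x : M, TangentSpace (𝓡 n) x) :
    ip (X + X') Y = ip X Y + ip X' Y := by
  funext x; exact inner_add_left _ _ _

theorem ip_smul_left (f : M → ℝ) (X Y : Π x : M, TangentSpace (𝓡 n) x) :
    ip (f • X) Y = f * ip X Y := by
  funext x; exact real_inner_smul_left _ _ _

theorem ip_add_right (X Y Y' : Π x : M, TangentSpace (𝓡 n) x) :
    ip X (Y + Y') = ip X Y + ip X Y' := by
  funext x; exact inner_add_right _ _ _

theorem ip_smul_right (f : M → ℝ) (X Y : Π x : M, TangentSpace (𝓡 n) x) :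
    ip X (f • Y) = f * ip X Y := by
  funext x; exact real_inner_smul_right _ _ _

theorem mdiff_ip {X Y : Π x : M, TangentSpace (𝓡 n) x} {x : M}
    (hX : DiffFieldAt X x) (hY : DiffFieldAt Y x) :
    MDifferentiableAt (𝓡 n) 𝓘(ℝ, ℝ) (ip X Y) x :=
  haveI : IsContMDiffRiemannianBundle (𝓡 n) 1 (EuclideanSpace ℝ (Fin n))
      (fun x : M ↦ TangentSpace (𝓡 n) x) := IsContMDiffRiemannianBundle.of_le (n := ∞) (by simp)
  MDifferentiableAt.inner_bundle hX hY

theorem d_ip_add {X X' Y : Π x : M, TangentSpace (𝓡 n) x} {x : M}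
    (hX : DiffFieldAt X x) (hX' : DiffFieldAt X' x) (hY : DiffFieldAt Y x)
    (v : TangentSpace (𝓡 n) x) :
    mvfderiv (𝓡 n) (ip (X + X') Y) x v
      = mvfderiv (𝓡 n) (ip X Y) x v + mvfderiv (𝓡 n) (ip X' Y) x v := by
  rw [ip_add_left, mvfderiv_add (mdiff_ip hX hY) (mdiff_ip hX' hY)]; rfl

theorem d_ip_smul {f : M → ℝ} {X Y : Π x : M, TangentSpace (𝓡 n) x} {x : M}
    (hf : MDifferentiableAt (𝓡 n) 𝓘(ℝ, ℝ) f x) (hX : DiffFieldAt X x) (hY : DiffFieldAt Y x)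
    (v : TangentSpace (𝓡 n) x) :
    mvfderiv (𝓡 n) (ip (f • X) Y) x v
      = f x * mvfderiv (𝓡 n) (ip X Y) x v + ip X Y x * mvfderiv (𝓡 n) f x v := by
  rw [ip_smul_left, mvfderiv_mul hf (mdiff_ip hX hY)]; rfl

theorem koszul_add₂ {X X' Y Z : Π x : M, TangentSpace (𝓡 n) x} {x : M}
    (hX : DiffFieldAt X x) (hX' : DiffFieldAt X' x) (hY : DiffFieldAt Y x)
    (hZ : DiffFieldAt Z x) :
    koszul Y (X + X') Z x = koszul Y X Z x + koszul Y X' Z x := by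
  simp only [koszul, d_ip_add hX hX' hY, d_ip_add hX hX' hZ]
  simp only [ip, mlieBracket_add_left hX hX', Pi.add_apply, inner_add_left, inner_add_right,
    map_add]
  ring

theorem koszul_smul₂ {f : M → ℝ} {X Y Z : Π x : M, TangentSpace (𝓡 n) x} {x : M}
    (hf : MDifferentiableAt (𝓡 n) 𝓘(ℝ, ℝ) f x)
    (hX : DiffFieldAt X x) (hY : DiffFieldAt Y x) (hZ : DiffFieldAt Z x) :
    koszul Y (f • X) Z x = f x * koszul Y X Z x := by
  simp only [koszul, d_ip_smul hf hX hY, d_ip_smul hf hX hZ]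
  simp only [ip, mlieBracket_smul_left hf hX, Pi.smul_apply', inner_add_left, inner_neg_left,
    neg_smul, real_inner_smul_left, real_inner_smul_right, map_smul, smul_eq_mul]
  ring

theorem koszul_add₃ {X Y Z Z' : Π x : M, TangentSpace (𝓡 n) x} {x : M}
    (hX : DiffFieldAt X x) (hY : DiffFieldAt Y x) (hZ : DiffFieldAt Z x)
    (hZ' : DiffFieldAt Z' x) :
    koszul Y X (Z + Z') x = koszul Y X Z x + koszul Y X Z' x := by
  simp only [koszul, ip_comm _ (Z + Z'), d_ip_add hZ hZ' hY, d_ip_add hZ hZ' hX]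
  simp only [ip_comm Y Z, ip_comm Y Z', ip_comm X Z, ip_comm X Z']
  simp only [ip, mlieBracket_add_right hZ hZ', Pi.add_apply, inner_add_left, map_add]
  simp only [real_inner_comm (mlieBracket (𝓡 n) X Y x)]
  ring

theorem koszul_smul₃ {f : M → ℝ} {X Y Z : Π x : M, TangentSpace (𝓡 n) x} {x : M}
    (hf : MDifferentiableAt (𝓡 n) 𝓘(ℝ, ℝ) f x)
    (hX : DiffFieldAt X x) (hY : DiffFieldAt Y x) (hZ : DiffFieldAt Z x) :
    koszul Y X (f • Z) x = f x * koszul Y X Z x := by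
  simp only [koszul, ip_comm _ (f • Z), d_ip_smul hf hZ hY, d_ip_smul hf hZ hX]
  simp only [ip_comm Y Z, ip_comm X Z, ip_smul_left, Pi.mul_apply]
  simp only [ip, mlieBracket_smul_right hf hZ, Pi.smul_apply', inner_add_left,
    real_inner_smul_left, map_smul, smul_eq_mul]
  rw [real_inner_comm (Z x)]
  ring

theorem koszul_add₁ {X Y Y' Z : Π x : M, TangentSpace (𝓡 n) x} {x : M}
    (hX : DiffFieldAt X x) (hY : DiffFieldAt Y x) (hY' : DiffFieldAt Y' x)
    (hZ : DiffFieldAt Z x) :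
    koszul (Y + Y') X Z x = koszul Y X Z x + koszul Y' X Z x := by
  simp only [koszul, ip_comm X (Y + Y'), d_ip_add hY hY' hZ, d_ip_add hY hY' hX]
  simp only [ip, mlieBracket_add_left hY hY', mlieBracket_add_right hY hY',
    ip_comm X Y, ip_comm X Y', Pi.add_apply, inner_add_left, inner_add_right, map_add]
  ring

theorem koszul_smul₁ {f : M → ℝ} {X Y Z : Π x : M, TangentSpace (𝓡 n) x} {x : M}
    (hf : MDifferentiableAt (𝓡 n) 𝓘(ℝ, ℝ) f x)
    (hX : DiffFieldAt X x) (hY : DiffFieldAt Y x) (hZ : DiffFieldAt Z x) :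
    koszul (f • Y) X Z x
      = f x * koszul Y X Z x + mvfderiv (𝓡 n) f x (X x) * ip Y Z x := by
  simp only [koszul, ip_comm X (f • Y), d_ip_smul hf hY hZ, d_ip_smul hf hY hX]
  simp only [ip, mlieBracket_smul_left hf hY, mlieBracket_smul_right hf hY, Pi.smul_apply',
    inner_add_left, inner_neg_left,
    neg_smul, real_inner_smul_left, real_inner_smul_right, map_smul, smul_eq_mul, ip_comm X Y]
  ring

theorem koszul_tensorial₂ {Y Z : Π x : M, TangentSpace (𝓡 n) x} {x : M}
    (hY : DiffFieldAt Y x) (hZ : DiffFieldAt Z x) :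
    TensorialAt (𝓡 n) (EuclideanSpace ℝ (Fin n)) (koszul Y · Z x) x where
  smul hf hX := koszul_smul₂ hf hX hY hZ
  add hX hX' := koszul_add₂ hX hX' hY hZ

theorem koszul_tensorial₃ {X Y : Π x : M, TangentSpace (𝓡 n) x} {x : M}
    (hX : DiffFieldAt X x) (hY : DiffFieldAt Y x) :
    TensorialAt (𝓡 n) (EuclideanSpace ℝ (Fin n)) (koszul Y X · x) x where
  smul hf hZ := koszul_smul₃ hf hX hY hZ
  add hZ hZ' := koszul_add₃ hX hY hZ hZ'

instance (x : M) : FiniteDimensional ℝ (TangentSpace (𝓡 n) x) :=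
  inferInstanceAs (FiniteDimensional ℝ (EuclideanSpace ℝ (Fin n)))

/-- The isomorphism `T_x^* M → T_x M` given by the metric. -/
def sharp (x : M) : (TangentSpace (𝓡 n) x →L[ℝ] ℝ) →L[ℝ] TangentSpace (𝓡 n) x :=
  haveI : CompleteSpace (TangentSpace (𝓡 n) x) := FiniteDimensional.complete ℝ _
  { toFun := (InnerProductSpace.toDual ℝ (TangentSpace (𝓡 n) x)).symm
    map_add' := map_add _
    map_smul' := fun c φ ↦ by simp
    cont := (InnerProductSpace.toDual ℝ (TangentSpace (𝓡 n) x)).symm.continuous }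

theorem inner_sharp (x : M) (φ : TangentSpace (𝓡 n) x →L[ℝ] ℝ) (v : TangentSpace (𝓡 n) x) :
    inner ℝ (sharp x φ) v = φ v :=
  have : CompleteSpace (TangentSpace (𝓡 n) x) := FiniteDimensional.complete ℝ _
  InnerProductSpace.toDual_symm_apply (𝕜 := ℝ) (E := TangentSpace (𝓡 n) x)

open Classical in
/-- The Levi-Civita connection: `∇ Y` at `x`, as the linear map `v ↦ ∇_v Y`. The vector `∇_v Y` is
determined by the Koszul formula; the theorems below show that this is the torsion-free connection
that is compatible with the metric. (If `Y` is not differentiable at `x`, the value is `0` by convention.) -/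
def covDeriv (Y : Π x : M, TangentSpace (𝓡 n) x) (x : M) :
    TangentSpace (𝓡 n) x →L[ℝ] TangentSpace (𝓡 n) x :=
  if hY : DiffFieldAt Y x then
    (sharp x).comp (TensorialAt.mkHom₂ (koszul Y · · x) x
      (fun _ hZ ↦ koszul_tensorial₂ hY hZ) (fun _ hX ↦ koszul_tensorial₃ hX hY))
  else 0

theorem inner_covDeriv {X Y Z : Π x : M, TangentSpace (𝓡 n) x} {x : M}
    (hX : DiffFieldAt X x) (hY : DiffFieldAt Y x) (hZ : DiffFieldAt Z x) :
    inner ℝ (covDeriv Y x (X x)) (Z x) = koszul Y X Z x := by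
  rw [covDeriv, dif_pos hY, ContinuousLinearMap.comp_apply, inner_sharp]
  exact TensorialAt.mkHom₂_apply _ _ hX hZ

/-- Compatibility with the metric: `X⟨Y, Z⟩ = ⟨∇_X Y, Z⟩ + ⟨Y, ∇_X Z⟩`. -/
theorem covDeriv_metric {X Y Z : Π x : M, TangentSpace (𝓡 n) x} {x : M}
    (hX : DiffFieldAt X x) (hY : DiffFieldAt Y x) (hZ : DiffFieldAt Z x) :
    mvfderiv (𝓡 n) (ip Y Z) x (X x)
      = inner ℝ (covDeriv Y x (X x)) (Z x) + inner ℝ (Y x) (covDeriv Z x (X x)) := by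
  rw [real_inner_comm _ (Y x), inner_covDeriv hX hY hZ, inner_covDeriv hX hZ hY]
  simp only [koszul, ip_comm Z Y, mlieBracket_swap (V := Z) (W := Y)]
  simp only [ip, Pi.neg_apply, inner_neg_left]
  ring

/-- `∇` is torsion-free: `∇_X Y - ∇_Y X = [X, Y]`. -/
theorem covDeriv_torsion {X Y : Π x : M, TangentSpace (𝓡 n) x} {x : M}
    (hX : DiffFieldAt X x) (hY : DiffFieldAt Y x) :
    covDeriv Y x (X x) - covDeriv X x (Y x) = mlieBracket (𝓡 n) X Y x := by
  refine ext_inner_right ℝ fun w ↦ ?_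
  have hW : DiffFieldAt (FiberBundle.extend (EuclideanSpace ℝ (Fin n)) w) x :=
    FiberBundle.mdifferentiableAt_extend ..
  have hw : w = FiberBundle.extend (EuclideanSpace ℝ (Fin n)) w x := by simp
  rw [inner_sub_left, hw, inner_covDeriv hX hY hW, inner_covDeriv hY hX hW]
  simp only [koszul, ip_comm Y X, mlieBracket_swap (V := Y) (W := X)]
  simp only [ip, Pi.neg_apply, inner_neg_left]
  ring

theorem covDeriv_add {Y Y' : Π x : M, TangentSpace (𝓡 n) x} {x : M}
    (hY : DiffFieldAt Y x) (hY' : DiffFieldAt Y' x) :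
    covDeriv (Y + Y') x = covDeriv Y x + covDeriv Y' x := by
  ext1 v
  refine ext_inner_right ℝ fun w ↦ ?_
  have hV : DiffFieldAt (FiberBundle.extend (EuclideanSpace ℝ (Fin n)) v) x :=
    FiberBundle.mdifferentiableAt_extend ..
  have hW : DiffFieldAt (FiberBundle.extend (EuclideanSpace ℝ (Fin n)) w) x :=
    FiberBundle.mdifferentiableAt_extend ..
  have hv : v = FiberBundle.extend (EuclideanSpace ℝ (Fin n)) v x := by simp
  have hw : w = FiberBundle.extend (EuclideanSpace ℝ (Fin n)) w x := by simp
  have hYY : DiffFieldAt (Y + Y') x := mdifferentiableAt_add_section hY hY'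
  rw [add_apply, inner_add_left, hv, hw, inner_covDeriv hV hYY hW,
    inner_covDeriv hV hY hW, inner_covDeriv hV hY' hW, koszul_add₁ hV hY hY' hW]

/-- Leibniz rule: `∇_v (f Y) = f ∇_v Y + df(v) Y`. -/
theorem covDeriv_smul {f : M → ℝ} {Y : Π x : M, TangentSpace (𝓡 n) x} {x : M}
    (hf : MDifferentiableAt (𝓡 n) 𝓘(ℝ, ℝ) f x) (hY : DiffFieldAt Y x)
    (v : TangentSpace (𝓡 n) x) :
    covDeriv (f • Y) x v = f x • covDeriv Y x v + mvfderiv (𝓡 n) f x v • Y x := by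
  refine ext_inner_right ℝ fun w ↦ ?_
  have hV : DiffFieldAt (FiberBundle.extend (EuclideanSpace ℝ (Fin n)) v) x :=
    FiberBundle.mdifferentiableAt_extend ..
  have hW : DiffFieldAt (FiberBundle.extend (EuclideanSpace ℝ (Fin n)) w) x :=
    FiberBundle.mdifferentiableAt_extend ..
  have hv : v = FiberBundle.extend (EuclideanSpace ℝ (Fin n)) v x := by simp
  have hw : w = FiberBundle.extend (EuclideanSpace ℝ (Fin n)) w x := by simp
  have hfY : DiffFieldAt (f • Y) x := hf.smul_section hY
  rw [inner_add_left, real_inner_smul_left, real_inner_smul_left, hv, hw,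
    inner_covDeriv hV hfY hW, inner_covDeriv hV hY hW, koszul_smul₁ hf hV hY hW]
  rfl

variable (n) in
/-- The gradient `∇f`: the vector with `⟨∇f, v⟩ = df(v)` for all `v`. -/
def grad (f : M → ℝ) (x : M) : TangentSpace (𝓡 n) x := sharp x (mvfderiv (𝓡 n) f x)

/-- The divergence `div X = ∑ ⟨∇_{τ_i} X, τ_i⟩`, that is, the trace of `v ↦ ∇_v X`. -/
def divg (X : Π x : M, TangentSpace (𝓡 n) x) (x : M) : ℝ :=
  LinearMap.trace ℝ (TangentSpace (𝓡 n) x) (covDeriv X x).toLinearMap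

variable (n) in
/-- The Laplace--Beltrami operator `Δ = div ∇`. -/
def laplacian (f : M → ℝ) : M → ℝ := divg (grad n f)

variable (n) in
/-- The covariant Hessian `(∇²f)(v, w) = ⟨v, ∇_w ∇f⟩`. -/
def hess (f : M → ℝ) (x : M) (v w : TangentSpace (𝓡 n) x) : ℝ :=
  inner ℝ v (covDeriv (grad n f) x w)

variable (n) in
/-- `|∇²f|²`, the squared norm of the covariant Hessian as a 2-tensor. -/
def hessNormSq (f : M → ℝ) (x : M) : ℝ :=
  ∑ i, ∑ j, hess n f x (stdOrthonormalBasis ℝ (TangentSpace (𝓡 n) x) i)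
    (stdOrthonormalBasis ℝ (TangentSpace (𝓡 n) x) j) ^ 2

/-- The vector field `X` is smooth. -/
def SmoothField (X : Π x : M, TangentSpace (𝓡 n) x) : Prop :=
  ContMDiff (𝓡 n) (𝓡 n).tangent ∞ (fun x ↦ (⟨x, X x⟩ : TangentBundle (𝓡 n) M))

/-- `X` is a Killing vector field: it is smooth and `⟨∇_Y X, Z⟩ + ⟨Y, ∇_Z X⟩ = 0` on `M` for all
(smooth) vector fields `Y`, `Z`. -/
def IsKilling (X : Π x : M, TangentSpace (𝓡 n) x) : Prop :=
  SmoothField X ∧ ∀ Y Z : Π x : M, TangentSpace (𝓡 n) x, SmoothField Y → SmoothField Z →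
    ∀ x : M, inner ℝ (covDeriv X x (Y x)) (Z x) + inner ℝ (Y x) (covDeriv X x (Z x)) = 0

variable [MeasurableSpace M]

/-- `√(det (g_ij))` at the point with coordinates `y` in the preferred chart at `c`, where
`g_ij = ⟨∂_i, ∂_j⟩` are the components of the metric in this chart. -/
def chartDensity (c : M) (y : EuclideanSpace ℝ (Fin n)) : ℝ :=
  √(Matrix.gram ℝ (fun i : Fin n ↦ (mfderiv 𝓘(ℝ, EuclideanSpace ℝ (Fin n)) (𝓡 n)
    (extChartAt (𝓡 n) c).symm y (EuclideanSpace.single i (1 : ℝ)) :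
      TangentSpace (𝓡 n) ((extChartAt (𝓡 n) c).symm y)))).det

/-- The measure `√(det (g_ij)) dy` of the preferred chart at `c`, transported to `M` (it is
supported in the domain of the chart). -/
def chartVolume (c : M) : Measure M :=
  Measure.map (extChartAt (𝓡 n) c).symm
    ((volume.restrict (extChartAt (𝓡 n) c).target).withDensity
      fun y ↦ ENNReal.ofReal (chartDensity c y))

variable (n M) in
/-- The Riemannian volume measure `dℋ^n`: the smallest measure on `M` that dominates
`√(det (g_ij)) dy` in every chart. As these measures agree on overlaps of charts (change of
variables), it is the measure which is given by `√(det (g_ij)) dy` in each chart. -/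
def riemVolume : Measure M := ⨆ c : M, chartVolume (n := n) c

variable (n) in
/-- The squared norm `∫ (|u|² + |∇u|² + |∇²u|²)` of a smooth function `u` in `H²(M)`. -/
def h2NormSq (u : M → ℝ) : ℝ≥0∞ :=
  ∫⁻ x, ENNReal.ofReal (u x ^ 2 + ‖grad n u x‖ ^ 2 + hessNormSq n u x) ∂(riemVolume n M)

/-- `f ∈ H²(M)`, with gradient `∇f = V` and Laplacian `Δf = L`.

The space `H²(M)` is the completion of the space of smooth functions of finite `H²` norm with
respect to this norm, regarded as a space of `L²` functions: `f` belongs to it when there are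
smooth functions `u_j` of finite `H²` norm that form a Cauchy sequence in this norm and converge to
`f` in `L²`. The gradient and the Laplacian of `f` are then the `L²` limits of `∇u_j` and `Δu_j`. -/
structure IsSobolevH2 (f : M → ℝ) (V : Π x : M, TangentSpace (𝓡 n) x) (L : M → ℝ) : Prop where
  aestronglyMeasurable : AEStronglyMeasurable f (riemVolume n M)
  aestronglyMeasurable_grad :
    AEStronglyMeasurable (fun x ↦ (⟨x, V x⟩ : TangentBundle (𝓡 n) M)) (riemVolume n M)
  aestronglyMeasurable_laplacian : AEStronglyMeasurable L (riemVolume n M)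
  exists_approx : ∃ u : ℕ → M → ℝ,
    (∀ j, ContMDiff (𝓡 n) 𝓘(ℝ, ℝ) ∞ (u j)) ∧
    (∀ j, h2NormSq n (u j) < ⊤) ∧
    Tendsto (fun p : ℕ × ℕ ↦ h2NormSq n (u p.1 - u p.2)) atTop (𝓝 0) ∧
    Tendsto (fun j ↦ ∫⁻ x, ‖u j x - f x‖ₑ ^ 2 ∂(riemVolume n M)) atTop (𝓝 0) ∧
    Tendsto (fun j ↦ ∫⁻ x, ‖grad n (u j) x - V x‖ₑ ^ 2 ∂(riemVolume n M)) atTop (𝓝 0) ∧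
    Tendsto (fun j ↦ ∫⁻ x, ‖laplacian n (u j) x - L x‖ₑ ^ 2 ∂(riemVolume n M)) atTop (𝓝 0)

end RiemCalc
end

/-!
For smooth functions `u`, `v` and a Killing field `X`, the field
`W = ⟨∇u, X⟩ ∇v + ⟨∇v, X⟩ ∇u - ⟨∇u, ∇v⟩ X`
has divergence `Δu ⟨∇v, X⟩ + Δv ⟨∇u, X⟩` (`RiemCalc.divg_energyField`): the Hessian
terms cancel by symmetry, and the terms with `∇X` vanish by the Killing equation. If `u`, `v` have
finite `H²` norm and `X` is bounded, then `W` and `div W` are integrable, so that `∫ div W = 0` by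
Gaffney's divergence theorem on complete manifolds (`RiemCalc.integral_divg_eq_zero`). Both sides
are continuous in the `L²` norms of gradients and Laplacians, which gives the theorem for general
elements of `H²` by approximation.

The divergence theorem rests on two facts. First, `|∫ ρ div W| ≤ ε ∫ |W|` for a compactly supported
function `ρ` with Lipschitz constant `ε` (`RiemCalc.abs_integral_mul_divg_le`). By a partition of
unity this reduces to a chart, where `√g div W = ∑ ∂_i (√g W^i)` (`RiemCalc.density_mul_divg`), the
Riemannian volume is `√g dy` (`RiemCalc.riemVolume_restrict_source`), and integration by parts
against the Lipschitz function `ρ` is allowed by Rademacher's theorem. Second, in a complete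
manifold closed balls are compact (`RiemCalc.isCompact_closedEBall`, the Hopf–Rinow theorem), so
that there are compactly supported `ρ_k → 1` with Lipschitz constants tending to `0`
(`RiemCalc.exists_cutoff`).
-/

noncomputable section

namespace RiemCalc

section Coordinates

variable {n : ℕ} {M : Type*} [TopologicalSpace M]
  [ChartedSpace (EuclideanSpace ℝ (Fin n)) M] [IsManifold (𝓡 n) ∞ M]
  [RiemannianBundle (fun x : M ↦ TangentSpace (𝓡 n) x)]
  [IsContMDiffRiemannianBundle (𝓡 n) ∞ (EuclideanSpace ℝ (Fin n))
    (fun x : M ↦ TangentSpace (𝓡 n) x)]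

/-! ### Coordinate vector fields -/

theorem mfderiv_symm_eq_symmL {c x : M} (hx : x ∈ (chartAt (EuclideanSpace ℝ (Fin n)) c).source) :
    (mfderiv 𝓘(ℝ, EuclideanSpace ℝ (Fin n)) (𝓡 n) (extChartAt (𝓡 n) c).symm (extChartAt (𝓡 n) c x))
     = (trivializationAt (EuclideanSpace ℝ (Fin n)) (TangentSpace (𝓡 n)) c).symmL ℝ x := by
  rw [TangentBundle.symmL_trivializationAt hx, ModelWithCorners.range_eq_univ, mfderivWithin_univ]

/-- The coordinate vector field `∂_i` of the preferred chart at `c` (zero off the chart domain). -/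
def coordField (c : M) (i : Fin n) (x : M) : TangentSpace (𝓡 n) x :=
  (trivializationAt (EuclideanSpace ℝ (Fin n)) (TangentSpace (𝓡 n)) c).localFrame
    (EuclideanSpace.basisFun (Fin n) ℝ).toBasis i x

theorem coordField_eq {c x : M} (hx : x ∈ (chartAt (EuclideanSpace ℝ (Fin n)) c).source)
    (i : Fin n) : coordField c i x =
    (trivializationAt (EuclideanSpace ℝ (Fin n)) (TangentSpace (𝓡 n)) c).symmL ℝ x
      (EuclideanSpace.single i (1 : ℝ)) := by
  have hb : x ∈ (trivializationAt (EuclideanSpace ℝ (Fin n)) (TangentSpace (𝓡 n)) c).baseSet := by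
    simpa using hx
  rw [coordField, Bundle.Trivialization.localFrame_apply_of_mem_baseSet _ _ hb]
  rw [Bundle.Trivialization.symmL_apply _ hb]
  simp [Bundle.Trivialization.basisAt]

theorem contMDiffAt_coordField {c x : M}
    (hx : x ∈ (chartAt (EuclideanSpace ℝ (Fin n)) c).source) (i : Fin n) :
    ContMDiffAt (𝓡 n) (𝓡 n).tangent ∞
      (fun x ↦ (⟨x, coordField c i x⟩ : TangentBundle (𝓡 n) M)) x :=
  contMDiffAt_localFrame_of_mem ∞ _ _ i (by simpa using hx)

theorem diffFieldAt_coordField {c x : M}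
    (hx : x ∈ (chartAt (EuclideanSpace ℝ (Fin n)) c).source) (i : Fin n) :
    DiffFieldAt (coordField c i) x :=
  (contMDiffAt_coordField hx i).mdifferentiableAt (by simp)

/-- The constant vector field on `ℝⁿ` given by the `i`-th standard basis vector. -/
def stdField (i : Fin n) (y : EuclideanSpace ℝ (Fin n)) :
    TangentSpace 𝓘(ℝ, EuclideanSpace ℝ (Fin n)) y :=
  (EuclideanSpace.single i (1 : ℝ) : EuclideanSpace ℝ (Fin n))

theorem mpullback_stdField {c x : M} (hx : x ∈ (chartAt (EuclideanSpace ℝ (Fin n)) c).source)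
    (i : Fin n) : mpullback (𝓡 n) 𝓘(ℝ, EuclideanSpace ℝ (Fin n)) (extChartAt (𝓡 n) c)
      (stdField i) x = coordField c i x := by
  rw [coordField_eq hx, mpullback_apply]
  have h1 := mfderivWithin_extChartAt_symm_comp_mfderiv_extChartAt' (I := 𝓡 n) (x := c)
    (y := x) (by simpa using hx)
  have h2 := mfderiv_extChartAt_comp_mfderivWithin_extChartAt_symm' (I := 𝓡 n) (x := c)
    (y := x) (by simpa using hx)
  rw [← TangentBundle.symmL_trivializationAt hx] at h1 h2
  rw [ContinuousLinearMap.inverse_eq h2 h1]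
  rfl

theorem two_le_infty : minSmoothness ℝ 2 ≤ (∞ : WithTop ℕ∞) := by
  rw [minSmoothness_of_isRCLikeNormedField]
  exact ENat.LEInfty.out

/-- Coordinate vector fields commute: they are pulled back from constant fields on `ℝⁿ`. -/
theorem mlieBracket_coordField {c x : M} (hx : x ∈ (chartAt (EuclideanSpace ℝ (Fin n)) c).source)
    (i j : Fin n) : mlieBracket (𝓡 n) (coordField c i) (coordField c j) x = 0 := by
  have : IsManifold (𝓡 n) (minSmoothness ℝ 2) M :=
    IsManifold.of_le (n := ∞) two_le_infty
  have key : ∀ i : Fin n, coordField c i =ᶠ[𝓝 x]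
      mpullback (𝓡 n) 𝓘(ℝ, EuclideanSpace ℝ (Fin n)) (extChartAt (𝓡 n) c)
      (stdField i) := fun i ↦ by
    filter_upwards [(chartAt _ c).open_source.mem_nhds hx] with y hy
    exact (mpullback_stdField hy i).symm
  have hd : ∀ i : Fin n, MDifferentiableAt 𝓘(ℝ, EuclideanSpace ℝ (Fin n))
      𝓘(ℝ, EuclideanSpace ℝ (Fin n)).tangent (fun y : EuclideanSpace ℝ (Fin n) ↦
      (⟨y, stdField i y⟩ : TangentBundle 𝓘(ℝ, EuclideanSpace ℝ (Fin n)) (EuclideanSpace ℝ (Fin n))))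
      (extChartAt (𝓡 n) c x) := fun i ↦ by
    have := (contMDiffAt_vectorSpace_iff_contDiffAt (𝕜 := ℝ) (n := 1) (V := stdField i)
      (x := extChartAt (𝓡 n) c x)).2 contDiffAt_const
    exact this.mdifferentiableAt (by simp)
  rw [(key i).mlieBracket_vectorField_eq (key j),
    ← mpullback_mlieBracket (n := ∞) (hd i) (hd j) (contMDiffAt_extChartAt' hx)
      two_le_infty, mpullback_apply]
  have : mlieBracket 𝓘(ℝ, EuclideanSpace ℝ (Fin n)) (stdField i) (stdField j)
      (extChartAt (𝓡 n) c x) = 0 := by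
    rw [← mlieBracketWithin_univ, mlieBracketWithin_eq_lieBracketWithin]
    have h (k : Fin n) (y : EuclideanSpace ℝ (Fin n)) :
        fderivWithin ℝ (fun _ : EuclideanSpace ℝ (Fin n) ↦
          (EuclideanSpace.single k (1 : ℝ) : EuclideanSpace ℝ (Fin n))) Set.univ y = 0 := by simp
    exact congrArg₂ (fun (A B : EuclideanSpace ℝ (Fin n) →L[ℝ] EuclideanSpace ℝ (Fin n)) ↦
        A (EuclideanSpace.single i (1 : ℝ)) - B (EuclideanSpace.single j (1 : ℝ)))
      (h j (extChartAt (𝓡 n) c x)) (h i (extChartAt (𝓡 n) c x)) |>.trans (by simp; rfl)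
  rw [this, map_zero]

/-- The components `W^i` of `W` in the preferred chart at `c`, with `W = ∑ W^i ∂_i` on the domain of
this chart. -/
def coordCoeff (W : Π x : M, TangentSpace (𝓡 n) x) (c : M) (i : Fin n) (x : M) : ℝ :=
  (trivializationAt (EuclideanSpace ℝ (Fin n)) (TangentSpace (𝓡 n)) c).localFrameCoeff (𝓡 n)
    (EuclideanSpace.basisFun (Fin n) ℝ).toBasis i x (W x)

theorem eq_sum_coordCoeff (W : Π x : M, TangentSpace (𝓡 n) x) {c x : M}
    (hx : x ∈ (chartAt (EuclideanSpace ℝ (Fin n)) c).source) :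
    W x = ∑ i, coordCoeff W c i x • coordField c i x :=
  Bundle.Trivialization.eq_sum_localFrameCoeff_smul (s := W) (by simpa using hx)

theorem contMDiffAt_coordCoeff {W : Π x : M, TangentSpace (𝓡 n) x} {c x : M}
    (hx : x ∈ (chartAt (EuclideanSpace ℝ (Fin n)) c).source)
    (hW : ContMDiffAt (𝓡 n) (𝓡 n).tangent ∞ (fun x ↦ (⟨x, W x⟩ : TangentBundle (𝓡 n) M)) x)
    (i : Fin n) : ContMDiffAt (𝓡 n) 𝓘(ℝ, ℝ) ∞ (coordCoeff W c i) x :=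
  contMDiffAt_localFrameCoeff _ (by simpa using hx) hW i

theorem mdifferentiableAt_coordCoeff {W : Π x : M, TangentSpace (𝓡 n) x} {c x : M}
    (hx : x ∈ (chartAt (EuclideanSpace ℝ (Fin n)) c).source) (hW : DiffFieldAt W x) (i : Fin n) :
    MDifferentiableAt (𝓡 n) 𝓘(ℝ, ℝ) (coordCoeff W c i) x :=
  mdifferentiableAt_localFrameCoeff _ (by simpa using hx) hW i

/-! ### Calculus of the divergence -/

/-- Jacobi's formula for the derivative of a determinant. -/
theorem hasDerivAt_det {n : ℕ} {G : ℝ → Matrix (Fin n) (Fin n) ℝ} {G' : Matrix (Fin n) (Fin n) ℝ}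
    {t : ℝ} (h : ∀ i j, HasDerivAt (fun s ↦ G s i j) (G' i j) t) :
    HasDerivAt (fun s ↦ (G s).det) ((G t).adjugate * G').trace t := by
  have h1 : HasDerivAt (fun s ↦ (G s).det) (∑ σ : Equiv.Perm (Fin n),
      ((Equiv.Perm.sign σ : ℤ) : ℝ) *
        ∑ k, (∏ i ∈ Finset.univ.erase k, G t (σ i) i) • G' (σ k) k) t := by
    simp only [Matrix.det_apply']
    exact HasDerivAt.fun_sum fun σ _ ↦ (HasDerivAt.fun_finsetProd fun i _ ↦ h (σ i) i).const_mul _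
  convert h1 using 1
  have h2 : ∀ k, ((G t).adjugate * G') k k = ((G t).updateCol k fun l ↦ G' l k).det := fun k ↦ by
    rw [← Matrix.cramer_apply, Matrix.cramer_eq_adjugate_mulVec]; rfl
  simp only [Matrix.trace, Matrix.diag, h2, Matrix.det_apply']
  rw [Finset.sum_comm]
  refine Finset.sum_congr rfl fun σ _ ↦ ?_
  rw [Finset.mul_sum]
  refine Finset.sum_congr rfl fun k _ ↦ ?_
  rw [← Finset.mul_prod_erase _ _ (Finset.mem_univ k), smul_eq_mul, mul_comm (∏ i ∈ _, _)]
  congr 1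
  rw [Matrix.updateCol_self]
  congr 1
  refine Finset.prod_congr rfl fun i hi ↦ ?_
  rw [Matrix.updateCol_ne (Finset.ne_of_mem_erase hi)]

theorem mvfderiv_congr {f g : M → ℝ} {x : M} (h : f =ᶠ[𝓝 x] g) :
    mvfderiv (𝓡 n) f x = mvfderiv (𝓡 n) g x := by
  ext1 v
  change (mfderiv (𝓡 n) 𝓘(ℝ, ℝ) f x v : ℝ) = mfderiv (𝓡 n) 𝓘(ℝ, ℝ) g x v
  rw [h.mfderiv_eq]
  rfl

/-- `∇ Y` at `x` depends only on the germ of `Y` at `x`. -/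
theorem covDeriv_congr {Y Y' : Π x : M, TangentSpace (𝓡 n) x} {x : M}
    (h : Y =ᶠ[𝓝 x] Y') (hY : DiffFieldAt Y x) (hY' : DiffFieldAt Y' x) :
    covDeriv Y x = covDeriv Y' x := by
  ext1 v
  refine ext_inner_right ℝ fun w ↦ ?_
  have hV : DiffFieldAt (FiberBundle.extend (EuclideanSpace ℝ (Fin n)) v) x :=
    FiberBundle.mdifferentiableAt_extend ..
  have hW : DiffFieldAt (FiberBundle.extend (EuclideanSpace ℝ (Fin n)) w) x :=
    FiberBundle.mdifferentiableAt_extend ..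
  have hv : v = FiberBundle.extend (EuclideanSpace ℝ (Fin n)) v x := by simp
  have hw : w = FiberBundle.extend (EuclideanSpace ℝ (Fin n)) w x := by simp
  rw [hv, hw, inner_covDeriv hV hY hW, inner_covDeriv hV hY' hW]
  have h1 (Z : Π x : M, TangentSpace (𝓡 n) x) : ip Y Z =ᶠ[𝓝 x] ip Y' Z := by
    filter_upwards [h] with y hy; simp only [ip, hy]
  have h2 (Z : Π x : M, TangentSpace (𝓡 n) x) :
      mvfderiv (𝓡 n) (ip Y Z) x = mvfderiv (𝓡 n) (ip Y' Z) x :=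
    mvfderiv_congr (h1 Z)
  simp only [koszul, ip_comm _ Y, ip_comm _ Y', h2, (h1 _).eq_of_nhds, h.eq_of_nhds]
  simp only [ip]
  have h3 (Z : Π x : M, TangentSpace (𝓡 n) x) :
      mlieBracket (𝓡 n) Y Z x = mlieBracket (𝓡 n) Y' Z x :=
    h.mlieBracket_vectorField_eq (EventuallyEq.refl _ Z)
  have h4 (Z : Π x : M, TangentSpace (𝓡 n) x) :
      mlieBracket (𝓡 n) Z Y x = mlieBracket (𝓡 n) Z Y' x :=
    (EventuallyEq.refl _ Z).mlieBracket_vectorField_eq h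
  rw [h3, h4]

theorem diffFieldAt_congr {Y Y' : Π x : M, TangentSpace (𝓡 n) x} {x : M}
    (h : Y =ᶠ[𝓝 x] Y') (hY : DiffFieldAt Y x) : DiffFieldAt Y' x := by
  refine hY.congr_of_eventuallyEq ?_
  filter_upwards [h] with y hy
  rw [hy]

theorem divg_congr {Y Y' : Π x : M, TangentSpace (𝓡 n) x} {x : M}
    (h : Y =ᶠ[𝓝 x] Y') (hY : DiffFieldAt Y x) : divg Y x = divg Y' x := by
  rw [divg, divg, covDeriv_congr h hY (diffFieldAt_congr h hY)]

theorem divg_add {Y Y' : Π x : M, TangentSpace (𝓡 n) x} {x : M}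
    (hY : DiffFieldAt Y x) (hY' : DiffFieldAt Y' x) :
    divg (Y + Y') x = divg Y x + divg Y' x := by
  simp [divg, covDeriv_add hY hY']

theorem divg_smul {f : M → ℝ} {Y : Π x : M, TangentSpace (𝓡 n) x} {x : M}
    (hf : MDifferentiableAt (𝓡 n) 𝓘(ℝ, ℝ) f x) (hY : DiffFieldAt Y x) :
    divg (f • Y) x = f x * divg Y x + mvfderiv (𝓡 n) f x (Y x) := by
  have : (covDeriv (f • Y) x).toLinearMap = f x • (covDeriv Y x).toLinearMap
      + (mvfderiv (𝓡 n) f x).toLinearMap.smulRight (Y x) := by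
    ext1 v; exact covDeriv_smul hf hY v
  rw [divg, this, map_add, map_smul, LinearMap.trace_smulRight]
  rfl

theorem diffFieldAt_zero (x : M) : DiffFieldAt (0 : Π x : M, TangentSpace (𝓡 n) x) x :=
  mdifferentiableAt_zeroSection ℝ (TangentSpace (𝓡 n))

theorem divg_zero (x : M) : divg (0 : Π x : M, TangentSpace (𝓡 n) x) x = 0 := by
  have := divg_add (diffFieldAt_zero (n := n) x) (diffFieldAt_zero x)
  simpa using this

theorem divg_sum {ι : Type*} (S : Finset ι) {Y : ι → Π x : M, TangentSpace (𝓡 n) x} {x : M}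
    (hY : ∀ i ∈ S, DiffFieldAt (Y i) x) :
    DiffFieldAt (∑ i ∈ S, Y i) x ∧ divg (∑ i ∈ S, Y i) x = ∑ i ∈ S, divg (Y i) x := by
  classical
  induction S using Finset.induction_on with
  | empty => simpa using ⟨diffFieldAt_zero x, divg_zero x⟩
  | insert a S ha ih =>
    obtain ⟨h1, h2⟩ := ih fun i hi ↦ hY i (Finset.mem_insert_of_mem hi)
    rw [Finset.sum_insert ha, Finset.sum_insert ha, ← h2]
    exact ⟨mdifferentiableAt_add_section (hY a (Finset.mem_insert_self _ _)) h1,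
      divg_add (hY a (Finset.mem_insert_self _ _)) h1⟩

theorem SmoothField.diffFieldAt {W : Π x : M, TangentSpace (𝓡 n) x} (hW : SmoothField W) (x : M) :
    DiffFieldAt W x := (hW x).mdifferentiableAt (by simp)

theorem SmoothField.contMDiff_ip {X Y : Π x : M, TangentSpace (𝓡 n) x} (hX : SmoothField X)
    (hY : SmoothField Y) : ContMDiff (𝓡 n) 𝓘(ℝ, ℝ) ∞ (ip X Y) :=
  ContMDiff.inner_bundle hX hY

theorem SmoothField.continuous_norm {W : Π x : M, TangentSpace (𝓡 n) x} (hW : SmoothField W) :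
    Continuous fun x ↦ ‖W x‖ := by
  have : (fun x ↦ ‖W x‖) = fun x ↦ √(ip W W x) := by
    funext x; exact norm_eq_sqrt_real_inner _
  rw [this]
  exact (hW.contMDiff_ip hW).continuous.sqrt

/-! ### The divergence in coordinates -/

theorem mdifferentiableAt_symm {c : M} {y : EuclideanSpace ℝ (Fin n)}
    (hy : y ∈ (extChartAt (𝓡 n) c).target) :
    MDifferentiableAt 𝓘(ℝ, EuclideanSpace ℝ (Fin n)) (𝓡 n) (extChartAt (𝓡 n) c).symm y := by
  have := mdifferentiableWithinAt_extChartAt_symm (I := 𝓡 n) hy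
  rwa [ModelWithCorners.range_eq_univ, mdifferentiableWithinAt_univ] at this

theorem mfderiv_symm_eq {c : M} {y : EuclideanSpace ℝ (Fin n)}
    (hy : y ∈ (extChartAt (𝓡 n) c).target) :
    (mfderiv 𝓘(ℝ, EuclideanSpace ℝ (Fin n)) (𝓡 n) (extChartAt (𝓡 n) c).symm y)
     = (trivializationAt (EuclideanSpace ℝ (Fin n)) (TangentSpace (𝓡 n)) c).symmL ℝ
        ((extChartAt (𝓡 n) c).symm y) := by
  have h := mfderiv_symm_eq_symmL (c := c) (x := (extChartAt (𝓡 n) c).symm y)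
    (by simpa using (extChartAt (𝓡 n) c).map_target hy)
  rwa [(extChartAt (𝓡 n) c).right_inv hy] at h

theorem mfderiv_symm_single {c : M} {y : EuclideanSpace ℝ (Fin n)}
    (hy : y ∈ (extChartAt (𝓡 n) c).target) (i : Fin n) :
    (mfderiv 𝓘(ℝ, EuclideanSpace ℝ (Fin n)) (𝓡 n) (extChartAt (𝓡 n) c).symm y
      (EuclideanSpace.single i (1 : ℝ)) : TangentSpace (𝓡 n) ((extChartAt (𝓡 n) c).symm y))
     = coordField c i ((extChartAt (𝓡 n) c).symm y) := by
  rw [coordField_eq (by simpa using (extChartAt (𝓡 n) c).map_target hy), mfderiv_symm_eq hy]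
  rfl

theorem symmL_eq_sum {c x : M} (hx : x ∈ (chartAt (EuclideanSpace ℝ (Fin n)) c).source)
    (v : EuclideanSpace ℝ (Fin n)) :
    (trivializationAt (EuclideanSpace ℝ (Fin n)) (TangentSpace (𝓡 n)) c).symmL ℝ x v
      = ∑ i, v i • coordField c i x := by
  conv_lhs => rw [← (EuclideanSpace.basisFun (Fin n) ℝ).sum_repr v]
  rw [map_sum]
  refine Finset.sum_congr rfl fun i _ ↦ ?_
  rw [coordField_eq hx, map_smul]
  simp

theorem mfderiv_symm_apply {c : M} {y : EuclideanSpace ℝ (Fin n)}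
    (hy : y ∈ (extChartAt (𝓡 n) c).target) (v : EuclideanSpace ℝ (Fin n)) :
    (mfderiv 𝓘(ℝ, EuclideanSpace ℝ (Fin n)) (𝓡 n) (extChartAt (𝓡 n) c).symm y
      v : TangentSpace (𝓡 n) ((extChartAt (𝓡 n) c).symm y))
     = ∑ i, v i • coordField c i ((extChartAt (𝓡 n) c).symm y) := by
  rw [← symmL_eq_sum (by simpa using (extChartAt (𝓡 n) c).map_target hy), mfderiv_symm_eq hy]
  rfl

theorem isOpen_target (c : M) : IsOpen (extChartAt (𝓡 n) c).target :=
  isOpen_extChartAt_target c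

/-- In the chart at `c`, the partial derivative of `h` is its derivative along `∂_i`. -/
theorem hasFDerivAt_comp_symm {c x : M} {h : M → ℝ}
    (hx : x ∈ (chartAt (EuclideanSpace ℝ (Fin n)) c).source)
    (hh : MDifferentiableAt (𝓡 n) 𝓘(ℝ, ℝ) h x) (i : Fin n) :
    HasFDerivAt (h ∘ (extChartAt (𝓡 n) c).symm)
      (fderiv ℝ (h ∘ (extChartAt (𝓡 n) c).symm) (extChartAt (𝓡 n) c x)) (extChartAt (𝓡 n) c x) ∧
    fderiv ℝ (h ∘ (extChartAt (𝓡 n) c).symm) (extChartAt (𝓡 n) c x) (EuclideanSpace.single i 1)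
      = mvfderiv (𝓡 n) h x (coordField c i x) := by
  have hx' : x ∈ (extChartAt (𝓡 n) c).source := by simpa using hx
  have hy := (extChartAt (𝓡 n) c).map_source hx'
  have hs : MDifferentiableAt 𝓘(ℝ, EuclideanSpace ℝ (Fin n)) (𝓡 n) (extChartAt (𝓡 n) c).symm
      (extChartAt (𝓡 n) c x) := mdifferentiableAt_symm hy
  have e := (extChartAt (𝓡 n) c).left_inv hx'
  constructor
  · exact (mdifferentiableAt_iff_differentiableAt.1
      (MDifferentiableAt.comp_of_eq (hg := hh) (hf := hs) (hy := e))).hasFDerivAt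
  · rw [← mfderiv_eq_fderiv, mfderiv_comp_of_eq hh hs e, mfderiv_symm_eq_symmL hx, coordField_eq hx]
    have key : ∀ z, z = x → ∀ v : EuclideanSpace ℝ (Fin n),
        (mfderiv (𝓡 n) 𝓘(ℝ, ℝ) h z v : ℝ) = mfderiv (𝓡 n) 𝓘(ℝ, ℝ) h x v := by
      rintro _ rfl v; rfl
    exact key _ e _

theorem hasDerivAt_line {c x : M} {h : M → ℝ}
    (hx : x ∈ (chartAt (EuclideanSpace ℝ (Fin n)) c).source)
    (hh : MDifferentiableAt (𝓡 n) 𝓘(ℝ, ℝ) h x) (i : Fin n) :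
    HasDerivAt (fun t : ℝ ↦ h ((extChartAt (𝓡 n) c).symm
        (extChartAt (𝓡 n) c x + t • EuclideanSpace.single i 1)))
      (mvfderiv (𝓡 n) h x (coordField c i x)) 0 := by
  obtain ⟨h1, h2⟩ := hasFDerivAt_comp_symm hx hh i
  rw [← h2]
  have h3 : HasDerivAt (fun t : ℝ ↦ extChartAt (𝓡 n) c x + t • EuclideanSpace.single i (1 : ℝ))
      (EuclideanSpace.single i (1 : ℝ)) 0 := by
    simpa using ((hasDerivAt_id (0 : ℝ)).smul_const
      (EuclideanSpace.single i (1 : ℝ))).const_add (extChartAt (𝓡 n) c x)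
  exact HasFDerivAt.comp_hasDerivAt_of_eq 0 h1 h3 (by simp)

/-- The coordinate vectors at a point of the chart domain, as a basis. -/
def coordBasis {c x : M} (hx : x ∈ (chartAt (EuclideanSpace ℝ (Fin n)) c).source) :
    Module.Basis (Fin n) ℝ (TangentSpace (𝓡 n) x) :=
  (trivializationAt (EuclideanSpace ℝ (Fin n)) (TangentSpace (𝓡 n)) c).basisAt
    (EuclideanSpace.basisFun (Fin n) ℝ).toBasis (by simpa using hx)

theorem coordBasis_apply {c x : M} (hx : x ∈ (chartAt (EuclideanSpace ℝ (Fin n)) c).source)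
    (i : Fin n) : coordBasis hx i = coordField c i x :=
  (Bundle.Trivialization.localFrame_apply_of_mem_baseSet _ _ (by simpa using hx)).symm

variable (n) in
/-- The Gram matrix of the coordinate vector fields. -/
def coordGram (c x : M) : Matrix (Fin n) (Fin n) ℝ :=
  Matrix.gram ℝ fun i : Fin n ↦ coordField c i x

theorem coordGram_apply (c x : M) (i j : Fin n) :
    coordGram n c x i j = ip (coordField c i) (coordField c j) x := rfl

theorem coordGram_det_pos {c x : M} (hx : x ∈ (chartAt (EuclideanSpace ℝ (Fin n)) c).source) :
    0 < (coordGram n c x).det := by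
  refine (Matrix.posDef_gram_of_linearIndependent ?_).det_pos
  have := (coordBasis hx).linearIndependent
  simpa only [funext (coordBasis_apply hx)] using this

variable (n) in
/-- The Riemannian density `√(det (g_ij))` of the chart at `c`, as a function on `M`. -/
def coordDensity (c x : M) : ℝ := √(coordGram n c x).det

theorem chartDensity_eq {c : M} {y : EuclideanSpace ℝ (Fin n)}
    (hy : y ∈ (extChartAt (𝓡 n) c).target) :
    chartDensity c y = coordDensity n c ((extChartAt (𝓡 n) c).symm y) := by
  simp only [chartDensity, coordDensity, coordGram, mfderiv_symm_single hy]

theorem coordDensity_pos {c x : M} (hx : x ∈ (chartAt (EuclideanSpace ℝ (Fin n)) c).source) :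
    0 < coordDensity n c x := Real.sqrt_pos.2 (coordGram_det_pos hx)

theorem contMDiffAt_coordGram {c x : M} (hx : x ∈ (chartAt (EuclideanSpace ℝ (Fin n)) c).source)
    (i j : Fin n) : ContMDiffAt (𝓡 n) 𝓘(ℝ, ℝ) ∞ (fun x ↦ coordGram n c x i j) x :=
  ContMDiffAt.inner_bundle (contMDiffAt_coordField hx i) (contMDiffAt_coordField hx j)

theorem contMDiffAt_det {G : M → Matrix (Fin n) (Fin n) ℝ} {x : M}
    (h : ∀ i j, ContMDiffAt (𝓡 n) 𝓘(ℝ, ℝ) ∞ (fun x ↦ G x i j) x) :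
    ContMDiffAt (𝓡 n) 𝓘(ℝ, ℝ) ∞ (fun x ↦ (G x).det) x := by
  simp only [Matrix.det_apply']
  refine ContMDiffAt.sum fun σ _ ↦ ContMDiffAt.mul contMDiffAt_const ?_
  exact contMDiffAt_finsetProd fun i _ ↦ h _ _

theorem contMDiffAt_coordDensity {c x : M}
    (hx : x ∈ (chartAt (EuclideanSpace ℝ (Fin n)) c).source) :
    ContMDiffAt (𝓡 n) 𝓘(ℝ, ℝ) ∞ (coordDensity n c) x := by
  have h1 : ContMDiffAt (𝓡 n) 𝓘(ℝ, ℝ) ∞ (fun x ↦ (coordGram n c x).det) x :=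
    contMDiffAt_det fun i j ↦ contMDiffAt_coordGram hx i j
  exact (contMDiffAt_iff_contDiffAt.2
    (Real.contDiffAt_sqrt (coordGram_det_pos hx).ne')).comp x h1

/-- `√g div ∂_i = ∂_i √g`. If `∇_{∂_j} ∂_i = ∑ a_{lj} ∂_l`, then `∂_i G = aᵀ G + G a` for the Gram
matrix `G` (the connection is metric and `∇_{∂_i} ∂_j = ∇_{∂_j} ∂_i`), and Jacobi's formula gives
`∂_i det G = 2 (tr a) det G`. -/
theorem density_mul_divg_coordField {c x : M}
    (hx : x ∈ (chartAt (EuclideanSpace ℝ (Fin n)) c).source) (i : Fin n) :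
    coordDensity n c x * divg (coordField c i) x
      = mvfderiv (𝓡 n) (coordDensity n c) x (coordField c i x) := by
  set b := coordBasis hx
  set a := LinearMap.toMatrix b b (covDeriv (coordField c i) x).toLinearMap with ha
  set G := coordGram n c x with hG
  have hE := fun j ↦ diffFieldAt_coordField (n := n) hx j
  have hA (j : Fin n) : covDeriv (coordField c i) x (coordField c j x)
      = ∑ l, a l j • coordField c l x := by
    rw [← coordBasis_apply hx j]
    have := b.sum_repr (covDeriv (coordField c i) x (b j))
    rw [← this]
    refine Finset.sum_congr rfl fun l _ ↦ ?_
    rw [ha, LinearMap.toMatrix_apply, ← coordBasis_apply hx l]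
    rfl
  have hsw (j : Fin n) : covDeriv (coordField c j) x (coordField c i x)
      = covDeriv (coordField c i) x (coordField c j x) := by
    have := covDeriv_torsion (hE i) (hE j)
    rwa [mlieBracket_coordField hx, sub_eq_zero] at this
  have hG' (j k : Fin n) : mvfderiv (𝓡 n) (fun x ↦ coordGram n c x j k) x (coordField c i x)
      = (a.transpose * G + G * a) j k := by
    have := covDeriv_metric (hE i) (hE j) (hE k)
    simp only [hsw, hA, sum_inner, inner_sum, real_inner_smul_left, real_inner_smul_right] at this
    refine this.trans ?_
    simp only [Matrix.add_apply, Matrix.mul_apply, Matrix.transpose_apply]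
    congr 1
    refine Finset.sum_congr rfl fun l _ ↦ ?_
    rw [mul_comm]; rfl
  have hd (j k : Fin n) := hasDerivAt_line hx
    ((contMDiffAt_coordGram (n := n) hx j k).mdifferentiableAt (by simp)) i
  simp only [hG'] at hd
  have h0 : (extChartAt (𝓡 n) c).symm (extChartAt (𝓡 n) c x
      + (0 : ℝ) • EuclideanSpace.single i 1) = x := by
    rw [zero_smul, add_zero]; exact (extChartAt (𝓡 n) c).left_inv (by simpa using hx)
  have h1 := (hasDerivAt_det hd).sqrt (by rw [h0]; exact (coordGram_det_pos hx).ne')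
  have h2 := hasDerivAt_line hx
    ((contMDiffAt_coordDensity (n := n) hx).mdifferentiableAt (by simp)) i
  have h3 := h2.unique h1
  rw [h3, h0, ← hG]
  have ht : divg (coordField c i) x = a.trace := by
    rw [divg, LinearMap.trace_eq_matrix_trace ℝ b]
  have htr : (G.adjugate * (a.transpose * G + G * a)).trace = 2 * G.det * a.trace := by
    rw [mul_add, Matrix.trace_add, ← mul_assoc, Matrix.trace_mul_comm, ← mul_assoc, ← mul_assoc,
      Matrix.mul_adjugate, Matrix.adjugate_mul]
    simp [Matrix.trace_smul]; ring
  have hp : 0 < G.det := coordGram_det_pos hx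
  rw [htr, ht, coordDensity, ← hG]
  have := Real.mul_self_sqrt hp.le
  have hs := Real.sqrt_pos.2 hp
  field_simp
  rw [pow_two, this, mul_comm]

/-- The divergence in coordinates: `√g div W = ∑ ∂_i (√g W^i)`. -/
theorem density_mul_divg {c x : M} {W : Π x : M, TangentSpace (𝓡 n) x}
    (hx : x ∈ (chartAt (EuclideanSpace ℝ (Fin n)) c).source) (hW : DiffFieldAt W x) :
    coordDensity n c x * divg W x
      = ∑ i, fderiv ℝ ((coordDensity n c * coordCoeff W c i) ∘ (extChartAt (𝓡 n) c).symm)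
        (extChartAt (𝓡 n) c x) (EuclideanSpace.single i 1) := by
  have hE := fun j ↦ diffFieldAt_coordField (n := n) hx j
  have ha := fun i ↦ mdifferentiableAt_coordCoeff hx hW i
  have hs := (contMDiffAt_coordDensity (n := n) hx).mdifferentiableAt (by simp)
  let Y : Fin n → Π x : M, TangentSpace (𝓡 n) x := fun i ↦ coordCoeff W c i • coordField c i
  have h0 : ∀ y ∈ (chartAt (EuclideanSpace ℝ (Fin n)) c).source, W y = (∑ i, Y i) y :=
    fun y hy ↦ by
      rw [Finset.sum_apply]
      exact eq_sum_coordCoeff W hy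
  have h1 := eventuallyEq_of_mem ((chartAt _ c).open_source.mem_nhds hx) h0
  have h2 := fun i ↦ (hasFDerivAt_comp_symm hx (hs.mul (ha i)) i).2
  rw [divg_congr h1 hW, (divg_sum (Y := Y) _ fun i _ ↦ (ha i).smul_section (hE i)).2,
    Finset.mul_sum]
  refine Finset.sum_congr rfl fun i _ ↦ ?_
  rw [divg_smul (ha i) (hE i), h2, mvfderiv_mul hs (ha i), mul_add, mul_left_comm,
    density_mul_divg_coordField hx]
  simp
  ring

theorem contDiffOn_comp_symm {c : M} {h : M → ℝ}
    (hh : ∀ x ∈ (chartAt (EuclideanSpace ℝ (Fin n)) c).source, ContMDiffAt (𝓡 n) 𝓘(ℝ, ℝ) ∞ h x) :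
    ContDiffOn ℝ ∞ (h ∘ (extChartAt (𝓡 n) c).symm) (extChartAt (𝓡 n) c).target := by
  rw [← contMDiffOn_iff_contDiffOn]
  refine ContMDiffOn.comp (t := (chartAt (EuclideanSpace ℝ (Fin n)) c).source)
    (fun x hx ↦ (hh x hx).contMDiffWithinAt) (contMDiffOn_extChartAt_symm c) ?_
  intro y hy
  simpa using (extChartAt (𝓡 n) c).map_target hy

theorem contDiffOn_density (c : M) :
    ContDiffOn ℝ ∞ (coordDensity n c ∘ (extChartAt (𝓡 n) c).symm) (extChartAt (𝓡 n) c).target :=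
  contDiffOn_comp_symm fun _ hx ↦ contMDiffAt_coordDensity hx

/-! ### Gradient and Hessian -/

theorem mvfderiv_coordField_eq {h : M → ℝ} (hh : ContMDiff (𝓡 n) 𝓘(ℝ, ℝ) ∞ h) {c x : M}
    (hx : x ∈ (chartAt (EuclideanSpace ℝ (Fin n)) c).source) (i : Fin n) :
    mvfderiv (𝓡 n) h x (coordField c i x)
      = fderiv ℝ (h ∘ (extChartAt (𝓡 n) c).symm) (extChartAt (𝓡 n) c x)
        (EuclideanSpace.single i 1) :=
  (hasFDerivAt_comp_symm hx ((hh x).mdifferentiableAt (by simp)) i).2.symm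

theorem contDiffAt_fderiv_comp_symm {h : M → ℝ} (hh : ContMDiff (𝓡 n) 𝓘(ℝ, ℝ) ∞ h) {c x : M}
    (hx : x ∈ (chartAt (EuclideanSpace ℝ (Fin n)) c).source) :
    ContDiffAt ℝ ∞ (fderiv ℝ (h ∘ (extChartAt (𝓡 n) c).symm)) (extChartAt (𝓡 n) c x) := by
  have hy := (extChartAt (𝓡 n) c).map_source (x := x) (by simpa using hx)
  exact ((contDiffOn_comp_symm fun x _ ↦ hh x).contDiffAt
    ((isOpen_target c).mem_nhds hy)).fderiv_right (m := ∞) (by simp)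

theorem contMDiffAt_mvfderiv_coordField {h : M → ℝ} (hh : ContMDiff (𝓡 n) 𝓘(ℝ, ℝ) ∞ h) {c x : M}
    (hx : x ∈ (chartAt (EuclideanSpace ℝ (Fin n)) c).source) (i : Fin n) :
    ContMDiffAt (𝓡 n) 𝓘(ℝ, ℝ) ∞ (fun y ↦ mvfderiv (𝓡 n) h y (coordField c i y)) x := by
  have h1 := ((contDiffAt_fderiv_comp_symm hh hx).clm_apply
    (contDiffAt_const (c := (EuclideanSpace.single i 1 : EuclideanSpace ℝ (Fin n))))).contMDiffAt
  refine (h1.comp x (contMDiffAt_extChartAt' hx)).congr_of_eventuallyEq ?_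
  filter_upwards [(chartAt _ c).open_source.mem_nhds hx] with y hy
  exact mvfderiv_coordField_eq hh hy i

theorem mvfderiv_mvfderiv_coordField {h : M → ℝ} (hh : ContMDiff (𝓡 n) 𝓘(ℝ, ℝ) ∞ h) {c x : M}
    (hx : x ∈ (chartAt (EuclideanSpace ℝ (Fin n)) c).source) (i j : Fin n) :
    mvfderiv (𝓡 n) (fun y ↦ mvfderiv (𝓡 n) h y (coordField c j y)) x (coordField c i x)
      = fderiv ℝ (fderiv ℝ (h ∘ (extChartAt (𝓡 n) c).symm)) (extChartAt (𝓡 n) c x)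
        (EuclideanSpace.single i 1) (EuclideanSpace.single j 1) := by
  rw [← (hasFDerivAt_comp_symm hx
    ((contMDiffAt_mvfderiv_coordField hh hx j).mdifferentiableAt (by simp)) i).2]
  have hy := (extChartAt (𝓡 n) c).map_source (x := x) (by simpa using hx)
  have h1 : (fun y ↦ mvfderiv (𝓡 n) h y (coordField c j y)) ∘ (extChartAt (𝓡 n) c).symm
      =ᶠ[𝓝 (extChartAt (𝓡 n) c x)] fun y ↦ fderiv ℝ (h ∘ (extChartAt (𝓡 n) c).symm) y
        (EuclideanSpace.single j 1) := by
    filter_upwards [(isOpen_target c).mem_nhds hy] with y hy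
    have h2 := (extChartAt (𝓡 n) c).map_target hy
    rw [Function.comp_apply, mvfderiv_coordField_eq hh (by simpa using h2),
      (extChartAt (𝓡 n) c).right_inv hy]
  rw [h1.fderiv_eq]
  have h3 := ((contDiffAt_fderiv_comp_symm hh hx).differentiableAt (by simp)).hasFDerivAt
  rw [(h3.clm_apply (hasFDerivAt_const (EuclideanSpace.single j 1) _)).fderiv]
  simp

/-- The second coordinate derivatives of a smooth function are symmetric. -/
theorem mvfderiv_mvfderiv_coordField_comm {h : M → ℝ} (hh : ContMDiff (𝓡 n) 𝓘(ℝ, ℝ) ∞ h) {c x : M}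
    (hx : x ∈ (chartAt (EuclideanSpace ℝ (Fin n)) c).source) (i j : Fin n) :
    mvfderiv (𝓡 n) (fun y ↦ mvfderiv (𝓡 n) h y (coordField c j y)) x (coordField c i x)
      = mvfderiv (𝓡 n) (fun y ↦ mvfderiv (𝓡 n) h y (coordField c i y)) x (coordField c j x) := by
  rw [mvfderiv_mvfderiv_coordField hh hx, mvfderiv_mvfderiv_coordField hh hx]
  have hy := (extChartAt (𝓡 n) c).map_source (x := x) (by simpa using hx)
  have h1 : ContDiffAt ℝ ∞ (h ∘ (extChartAt (𝓡 n) c).symm) (extChartAt (𝓡 n) c x) :=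
    (contDiffOn_comp_symm fun x _ ↦ hh x).contDiffAt ((isOpen_target c).mem_nhds hy)
  exact (h1.isSymmSndFDerivAt two_le_infty).eq _ _

theorem ip_grad (u : M → ℝ) (Y : Π x : M, TangentSpace (𝓡 n) x) (x : M) :
    ip (grad n u) Y x = mvfderiv (𝓡 n) u x (Y x) :=
  inner_sharp x _ _

theorem contMDiffAt_matrix_inv {G : M → Matrix (Fin n) (Fin n) ℝ} {x : M}
    (h : ∀ i j, ContMDiffAt (𝓡 n) 𝓘(ℝ, ℝ) ∞ (fun x ↦ G x i j) x) (h0 : (G x).det ≠ 0)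
    (i j : Fin n) : ContMDiffAt (𝓡 n) 𝓘(ℝ, ℝ) ∞ (fun x ↦ (G x)⁻¹ i j) x := by
  simp only [Matrix.inv_def, Ring.inverse_eq_inv', Matrix.smul_apply, Matrix.adjugate_apply,
    smul_eq_mul]
  refine ((contMDiffAt_det h).inv₀ h0).mul (contMDiffAt_det fun k l ↦ ?_)
  by_cases hk : k = j
  · subst hk
    simpa only [Matrix.updateRow_self] using contMDiffAt_const
  · simpa only [Matrix.updateRow_ne hk] using h k l

/-- The gradient in coordinates: `∇u = ∑ g^{jk} (∂_j u) ∂_k`. -/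
theorem grad_eq_sum (u : M → ℝ) {c x : M}
    (hx : x ∈ (chartAt (EuclideanSpace ℝ (Fin n)) c).source) :
    grad n u x = ∑ k, (∑ j, mvfderiv (𝓡 n) u x (coordField c j x) * (coordGram n c x)⁻¹ j k) •
      coordField c k x := by
  set a : Fin n → ℝ := fun k ↦ coordCoeff (grad n u) c k x with ha
  set d : Fin n → ℝ := fun j ↦ mvfderiv (𝓡 n) u x (coordField c j x) with hd
  have h1 : grad n u x = ∑ k, a k • coordField c k x := eq_sum_coordCoeff (grad n u) hx
  have h2 : Matrix.vecMul a (coordGram n c x) = d := by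
    funext j
    have h3 : d j = inner ℝ (grad n u x) (coordField c j x) := (inner_sharp x _ _).symm
    rw [h3, h1, sum_inner, Matrix.vecMul_eq_sum, Finset.sum_apply]
    exact Finset.sum_congr rfl fun k _ ↦
      (real_inner_smul_left (coordField c k x) (coordField c j x) (a k)).symm
  have h4 : a = Matrix.vecMul d (coordGram n c x)⁻¹ := by
    rw [← h2, Matrix.vecMul_vecMul, Matrix.mul_nonsing_inv _ (coordGram_det_pos hx).ne'.isUnit,
      Matrix.vecMul_one]
  rw [h1]
  exact Finset.sum_congr rfl fun k _ ↦ congrArg (· • coordField c k x) (congrFun h4 k)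

theorem smoothField_grad {u : M → ℝ} (hu : ContMDiff (𝓡 n) 𝓘(ℝ, ℝ) ∞ u) :
    SmoothField (grad n u) := by
  intro x
  have hx := mem_chart_source (EuclideanSpace ℝ (Fin n)) x
  let Y : Fin n → Π y : M, TangentSpace (𝓡 n) y := fun k ↦
    (fun y ↦ ∑ j, mvfderiv (𝓡 n) u y (coordField x j y) * (coordGram n x y)⁻¹ j k) •
      coordField x k
  have hY : ContMDiffAt (𝓡 n) (𝓡 n).tangent ∞
      (fun y ↦ (⟨y, ∑ k, Y k y⟩ : TangentBundle (𝓡 n) M)) x := by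
    refine ContMDiffAt.sum_section fun k _ ↦ ContMDiffAt.smul_section ?_
      (contMDiffAt_coordField hx k)
    exact ContMDiffAt.sum fun j _ ↦ (contMDiffAt_mvfderiv_coordField hu hx j).mul
      (contMDiffAt_matrix_inv (contMDiffAt_coordGram hx) (coordGram_det_pos hx).ne' j k)
  refine hY.congr_of_eventuallyEq ?_
  filter_upwards [(chartAt _ x).open_source.mem_nhds hx] with y hy
  exact congrArg (fun v ↦ (⟨y, v⟩ : TangentBundle (𝓡 n) M)) (grad_eq_sum u hy)

/-- The covariant Hessian is symmetric. -/
theorem inner_covDeriv_grad_comm {u : M → ℝ} (hu : ContMDiff (𝓡 n) 𝓘(ℝ, ℝ) ∞ u) (x : M)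
    (v w : TangentSpace (𝓡 n) x) :
    inner ℝ (covDeriv (grad n u) x v) w = inner ℝ (covDeriv (grad n u) x w) v := by
  have hx := mem_chart_source (EuclideanSpace ℝ (Fin n)) x
  have hE := fun j ↦ diffFieldAt_coordField (n := n) hx j
  have hg := (smoothField_grad hu).diffFieldAt x
  have key (i j : Fin n) : inner ℝ (covDeriv (grad n u) x (coordField x i x)) (coordField x j x)
      = inner ℝ (covDeriv (grad n u) x (coordField x j x)) (coordField x i x) := by
    have h1 := covDeriv_metric (hE i) hg (hE j)
    have h2 := covDeriv_metric (hE j) hg (hE i)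
    have h3 := mvfderiv_mvfderiv_coordField_comm hu hx i j
    have h4 := covDeriv_torsion (hE i) (hE j)
    rw [mlieBracket_coordField hx, sub_eq_zero] at h4
    rw [funext (ip_grad u (coordField x j))] at h1
    rw [funext (ip_grad u (coordField x i))] at h2
    rw [h4] at h1
    linarith
  have hb : ∀ v : TangentSpace (𝓡 n) x, ∃ a : Fin n → ℝ, v = ∑ i, a i • coordField x i x := fun v ↦
    ⟨fun i ↦ (coordBasis hx).repr v i, by
      simpa only [coordBasis_apply] using ((coordBasis hx).sum_repr v).symm⟩
  obtain ⟨a, rfl⟩ := hb v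
  obtain ⟨b, rfl⟩ := hb w
  simp only [map_sum, map_smul, sum_inner, inner_sum, real_inner_smul_left, real_inner_smul_right]
  rw [Finset.sum_comm]
  refine Finset.sum_congr rfl fun j _ ↦ Finset.sum_congr rfl fun i _ ↦ ?_
  rw [key i j]; ring

/-! ### Killing fields -/

/-- Every tangent vector extends to a smooth vector field. -/
theorem exists_smoothField_eq [T2Space M] {x : M} (v : TangentSpace (𝓡 n) x) :
    ∃ Y : Π x : M, TangentSpace (𝓡 n) x, SmoothField Y ∧ Y x = v := by
  obtain ⟨s, hs, hsm⟩ := FiberBundle.exists_contMDiffOn_extend (I := 𝓡 n) (k := ∞)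
    (EuclideanSpace ℝ (Fin n)) v
  obtain ⟨f, -, hf⟩ := (SmoothBumpFunction.nhds_basis_tsupport (I := 𝓡 n) x).mem_iff.1
    (interior_mem_nhds.2 hs)
  refine ⟨(f : M → ℝ) • FiberBundle.extend (EuclideanSpace ℝ (Fin n)) v,
    ContMDiffOn.smul_section_of_tsupport f.contMDiff.contMDiffOn isOpen_interior hf
      (hsm.mono interior_subset), ?_⟩
  show f x • FiberBundle.extend (EuclideanSpace ℝ (Fin n)) v x = v
  rw [f.eq_one, one_smul, FiberBundle.extend_apply_self]

/-- The Killing equation for tangent vectors. -/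
theorem IsKilling.inner_covDeriv_add [T2Space M] {X : Π x : M, TangentSpace (𝓡 n) x}
    (hX : IsKilling X) {x : M} (v w : TangentSpace (𝓡 n) x) :
    inner ℝ (covDeriv X x v) w + inner ℝ v (covDeriv X x w) = 0 := by
  obtain ⟨Y, hY, rfl⟩ := exists_smoothField_eq v
  obtain ⟨Z, hZ, rfl⟩ := exists_smoothField_eq w
  exact hX.2 Y Z hY hZ x

theorem IsKilling.divg_eq_zero [T2Space M] {X : Π x : M, TangentSpace (𝓡 n) x} (hX : IsKilling X)
    (x : M) : divg X x = 0 := by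
  rw [divg, LinearMap.trace_eq_sum_inner _ (stdOrthonormalBasis ℝ (TangentSpace (𝓡 n) x))]
  refine Finset.sum_eq_zero fun i _ ↦ ?_
  have := hX.inner_covDeriv_add (stdOrthonormalBasis ℝ (TangentSpace (𝓡 n) x) i)
    (stdOrthonormalBasis ℝ (TangentSpace (𝓡 n) x) i)
  rw [real_inner_comm] at this
  simp only [ContinuousLinearMap.coe_coe]
  linarith

/-- The field `⟨∇u, X⟩ ∇v + ⟨∇v, X⟩ ∇u - ⟨∇u, ∇v⟩ X`. For smooth `u`, `v` and a Killing field `X`,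
its divergence is `Δu ⟨∇v, X⟩ + Δv ⟨∇u, X⟩`. -/
def energyField (u v : M → ℝ) (X : Π x : M, TangentSpace (𝓡 n) x) :
    Π x : M, TangentSpace (𝓡 n) x :=
  (ip (grad n u) X • grad n v + ip (grad n v) X • grad n u) +
    (-ip (grad n u) (grad n v)) • X

theorem smoothField_energyField {u v : M → ℝ} (hu : ContMDiff (𝓡 n) 𝓘(ℝ, ℝ) ∞ u)
    (hv : ContMDiff (𝓡 n) 𝓘(ℝ, ℝ) ∞ v) {X : Π x : M, TangentSpace (𝓡 n) x} (hX : SmoothField X) :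
    SmoothField (energyField u v X) := by
  have hU := smoothField_grad hu
  have hV := smoothField_grad hv
  have h1 : SmoothField (ip (grad n u) X • grad n v) := (hU.contMDiff_ip hX).smul_section hV
  have h2 : SmoothField (ip (grad n v) X • grad n u) := (hV.contMDiff_ip hX).smul_section hU
  have h3 : SmoothField ((-ip (grad n u) (grad n v)) • X) :=
    (hU.contMDiff_ip hV).neg.smul_section hX
  exact (ContMDiff.add_section h1 h2).add_section h3

/-- The terms with second derivatives of `u` and `v` cancel because the Hessian is symmetric, those
with the first derivative of `X` because of the Killing equation, which also gives `div X = 0`. -/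
theorem divg_energyField [T2Space M] {u v : M → ℝ} (hu : ContMDiff (𝓡 n) 𝓘(ℝ, ℝ) ∞ u)
    (hv : ContMDiff (𝓡 n) 𝓘(ℝ, ℝ) ∞ v) {X : Π x : M, TangentSpace (𝓡 n) x} (hX : IsKilling X)
    (x : M) : divg (energyField u v X) x
      = laplacian n u x * inner ℝ (grad n v x) (X x)
        + laplacian n v x * inner ℝ (grad n u x) (X x) := by
  have hU := (smoothField_grad hu).diffFieldAt x
  have hV := (smoothField_grad hv).diffFieldAt x
  have hX' := hX.1.diffFieldAt x
  have m1 := mdiff_ip hU hX'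
  have m2 := mdiff_ip hV hX'
  have m3 := (mdiff_ip hU hV).neg
  have d1 : DiffFieldAt (ip (grad n u) X • grad n v) x := m1.smul_section hV
  have d2 : DiffFieldAt (ip (grad n v) X • grad n u) x := m2.smul_section hU
  have d3 : DiffFieldAt ((-ip (grad n u) (grad n v)) • X) x := m3.smul_section hX'
  rw [energyField, divg_add (mdifferentiableAt_add_section d1 d2) d3, divg_add d1 d2,
    divg_smul m1 hV, divg_smul m2 hU, divg_smul m3 hX', hX.divg_eq_zero, mvfderiv_neg]
  have h1 := covDeriv_metric hV hU hX'
  have h2 := covDeriv_metric hU hV hX'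
  have h3 := covDeriv_metric hX' hU hV
  have s1 := inner_covDeriv_grad_comm hu x (grad n v x) (X x)
  have s2 := inner_covDeriv_grad_comm hv x (grad n u x) (X x)
  have hk := hX.inner_covDeriv_add (grad n v x) (grad n u x)
  -- brings all inner products into the same order, for the linear combination at the end
  rw [real_inner_comm (grad n u x)] at hk
  rw [real_inner_comm (covDeriv (grad n v) x (X x)), ← s2, ← s1] at h3
  rw [h1, h2, neg_apply, h3]
  simp only [ip, laplacian]
  linarith

/-! ### The Riemannian volume in a chart -/

variable [MeasurableSpace M] [BorelSpace M]

theorem measurableSet_target_inter (c : M) {t : Set M} (ht : MeasurableSet t) :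
    MeasurableSet ((extChartAt (𝓡 n) c).target ∩ (extChartAt (𝓡 n) c).symm ⁻¹' t) := by
  have h := (continuousOn_iff_continuous_domRestrict.1
    (continuousOn_extChartAt_symm (I := 𝓡 n) c)).measurable ht
  have := (isOpen_target (n := n) c).measurableSet.subtype_image h
  convert this using 1
  ext y; simp [and_comm]

theorem aemeasurable_symm (c : M) : AEMeasurable (extChartAt (𝓡 n) c).symm
    (volume.restrict (extChartAt (𝓡 n) c).target) :=
  (continuousOn_extChartAt_symm c).aemeasurable (isOpen_target c).measurableSet

theorem chartVolume_eq (c : M) : chartVolume (n := n) c = Measure.map (extChartAt (𝓡 n) c).symm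
    ((volume.restrict (extChartAt (𝓡 n) c).target).withDensity
      fun y ↦ ENNReal.ofReal (coordDensity n c ((extChartAt (𝓡 n) c).symm y))) := by
  rw [chartVolume]
  congr 1
  refine withDensity_congr_ae ?_
  filter_upwards [ae_restrict_mem (isOpen_target c).measurableSet] with y hy
  rw [chartDensity_eq hy]

theorem chartVolume_apply (c : M) {t : Set M} (ht : MeasurableSet t) :
    chartVolume (n := n) c t =
      ∫⁻ y in (extChartAt (𝓡 n) c).target ∩ (extChartAt (𝓡 n) c).symm ⁻¹' t,
        ENNReal.ofReal (coordDensity n c ((extChartAt (𝓡 n) c).symm y)) := by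
  rw [chartVolume_eq, Measure.map_apply_of_aemeasurable
    ((aemeasurable_symm c).mono_ac (withDensity_absolutelyContinuous _ _)) ht,
    withDensity_apply', Measure.restrict_restrict' (isOpen_target c).measurableSet, Set.inter_comm]

theorem eq_sum_mfderiv_extChartAt {c x : M} (hx : x ∈ (chartAt (EuclideanSpace ℝ (Fin n)) c).source)
    (v : TangentSpace (𝓡 n) x) :
    v = ∑ i, (show EuclideanSpace ℝ (Fin n) from mfderiv (𝓡 n) 𝓘(ℝ, EuclideanSpace ℝ (Fin n))
      (extChartAt (𝓡 n) c) x v) i • coordField c i x := by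
  have h1 := mfderivWithin_extChartAt_symm_comp_mfderiv_extChartAt' (I := 𝓡 n) (x := c)
    (y := x) (by simpa using hx)
  rw [← TangentBundle.symmL_trivializationAt hx] at h1
  rw [← symmL_eq_sum hx]
  exact (congrArg (fun L : TangentSpace (𝓡 n) x →L[ℝ] TangentSpace (𝓡 n) x ↦ L v) h1).symm

variable (n) in
/-- The transition map from the chart at `c'` to the chart at `c`. -/
def transition (c c' : M) : EuclideanSpace ℝ (Fin n) → EuclideanSpace ℝ (Fin n) :=
  extChartAt (𝓡 n) c ∘ (extChartAt (𝓡 n) c').symm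

/-- The differential of the transition map expresses one coordinate frame in terms of the other. -/
theorem hasFDerivAt_transition {c c' : M} {y : EuclideanSpace ℝ (Fin n)}
    (hy : y ∈ (extChartAt (𝓡 n) c').target)
    (hy' : (extChartAt (𝓡 n) c').symm y ∈ (chartAt (EuclideanSpace ℝ (Fin n)) c).source) :
    HasFDerivAt (transition n c c') (fderiv ℝ (transition n c c') y) y ∧
    ∀ i, coordField c' i ((extChartAt (𝓡 n) c').symm y)
      = ∑ j, (fderiv ℝ (transition n c c') y (EuclideanSpace.single i 1)) j •
        coordField c j ((extChartAt (𝓡 n) c').symm y) := by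
  have hs := mdifferentiableAt_symm hy
  have hc := mdifferentiableAt_extChartAt (I := 𝓡 n) hy'
  constructor
  · exact (mdifferentiableAt_iff_differentiableAt.1
      (MDifferentiableAt.comp (hg := hc) (hf := hs))).hasFDerivAt
  · intro i
    have h := mfderiv_comp y hc hs
    rw [← mfderiv_symm_single hy i]
    refine (eq_sum_mfderiv_extChartAt hy' _).trans (Finset.sum_congr rfl fun j _ ↦ ?_)
    rw [← mfderiv_eq_fderiv]
    congr 1
    rw [transition, h]
    rfl

/-- The densities of two charts differ by the Jacobian determinant of the transition map. -/
theorem coordDensity_transition {c c' : M} {y : EuclideanSpace ℝ (Fin n)}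
    (hy : y ∈ (extChartAt (𝓡 n) c').target)
    (hy' : (extChartAt (𝓡 n) c').symm y ∈ (chartAt (EuclideanSpace ℝ (Fin n)) c).source) :
    coordDensity n c' ((extChartAt (𝓡 n) c').symm y) =
      |(fderiv ℝ (transition n c c') y).det| * coordDensity n c ((extChartAt (𝓡 n) c').symm y) := by
  set x := (extChartAt (𝓡 n) c').symm y
  set b := (EuclideanSpace.basisFun (Fin n) ℝ).toBasis
  set J := LinearMap.toMatrix b b (fderiv ℝ (transition n c c') y).toLinearMap with hJ
  have h : coordGram n c' x = J.transpose * coordGram n c x * J := by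
    ext i j
    change inner ℝ (coordField c' i x) (coordField c' j x) = _
    have h1 : ∀ i, coordField c' i x = ∑ j, (fderiv ℝ (transition n c c') y
        (EuclideanSpace.single i 1)) j • coordField c j x := (hasFDerivAt_transition hy hy').2
    rw [h1 i, h1 j]
    simp only [sum_inner, inner_sum, real_inner_smul_left, real_inner_smul_right,
      Matrix.mul_apply, Matrix.transpose_apply, Finset.sum_mul, hJ, LinearMap.toMatrix_apply]
    refine Finset.sum_congr rfl fun k _ ↦ Finset.sum_congr rfl fun l _ ↦ ?_
    simp [b, coordGram_apply, ip]
    ring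
  have hdet : (fderiv ℝ (transition n c c') y).det = J.det := by
    rw [hJ, LinearMap.det_toMatrix]
  rw [coordDensity, coordDensity, h, Matrix.det_mul, Matrix.det_mul, Matrix.det_transpose, hdet,
    mul_right_comm, ← pow_two, Real.sqrt_mul (sq_nonneg _), Real.sqrt_sq_eq_abs]

/-- The volumes of two charts agree on the overlap, by the change of variables formula. -/
theorem chartVolume_eq_of_subset {c c' : M} {t : Set M} (ht : MeasurableSet t)
    (h : t ⊆ (chartAt (EuclideanSpace ℝ (Fin n)) c).source)
    (h' : t ⊆ (chartAt (EuclideanSpace ℝ (Fin n)) c').source) :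
    chartVolume (n := n) c t = chartVolume (n := n) c' t := by
  rw [chartVolume_apply c ht, chartVolume_apply c' ht]
  set S' := (extChartAt (𝓡 n) c').target ∩ (extChartAt (𝓡 n) c').symm ⁻¹' t with hS'
  have him : (extChartAt (𝓡 n) c).target ∩ (extChartAt (𝓡 n) c).symm ⁻¹' t
      = transition n c c' '' S' := by
    ext y
    constructor
    · rintro ⟨hy, hyt⟩
      have hm : (extChartAt (𝓡 n) c).symm y ∈ (extChartAt (𝓡 n) c').source := by
        simpa using h' hyt
      refine ⟨extChartAt (𝓡 n) c' ((extChartAt (𝓡 n) c).symm y),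
        ⟨(extChartAt (𝓡 n) c').map_source hm, ?_⟩, ?_⟩
      · rw [Set.mem_preimage, (extChartAt (𝓡 n) c').left_inv hm]; exact hyt
      · rw [transition, Function.comp_apply, (extChartAt (𝓡 n) c').left_inv hm,
          (extChartAt (𝓡 n) c).right_inv hy]
    · rintro ⟨z, ⟨hz, hzt⟩, rfl⟩
      have hm : (extChartAt (𝓡 n) c').symm z ∈ (extChartAt (𝓡 n) c).source := by
        simpa using h hzt
      refine ⟨(extChartAt (𝓡 n) c).map_source hm, ?_⟩
      rw [Set.mem_preimage, transition, Function.comp_apply, (extChartAt (𝓡 n) c).left_inv hm]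
      exact hzt
  have hinj : Set.InjOn (transition n c c') S' := by
    rintro z ⟨hz, hzt⟩ w ⟨hw, hwt⟩ hzw
    have := (extChartAt (𝓡 n) c).injOn (by simpa using h hzt) (by simpa using h hwt) hzw
    exact (extChartAt (𝓡 n) c').symm.injOn hz hw this
  rw [him, lintegral_image_eq_lintegral_abs_det_fderiv_mul volume
    (measurableSet_target_inter c' ht)
    (fun y hy ↦ (hasFDerivAt_transition hy.1 (h hy.2)).1.hasFDerivWithinAt) hinj]
  refine setLIntegral_congr_fun (measurableSet_target_inter c' ht) fun y hy ↦ ?_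
  have hm : (extChartAt (𝓡 n) c').symm y ∈ (extChartAt (𝓡 n) c).source := by
    simpa using h hy.2
  rw [coordDensity_transition hy.1 (h hy.2), ENNReal.ofReal_mul (abs_nonneg _), transition,
    Function.comp_apply, (extChartAt (𝓡 n) c).left_inv hm]

theorem chartVolume_compl_source (c : M) :
    chartVolume (n := n) c ((chartAt (EuclideanSpace ℝ (Fin n)) c).source)ᶜ = 0 := by
  rw [chartVolume_apply c (chartAt _ c).open_source.measurableSet.compl]
  have : (extChartAt (𝓡 n) c).target ∩ (extChartAt (𝓡 n) c).symm ⁻¹'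
      ((chartAt (EuclideanSpace ℝ (Fin n)) c).source)ᶜ = ∅ := by
    ext y
    simp only [Set.mem_inter_iff, Set.mem_preimage, Set.mem_compl_iff, Set.mem_empty_iff_false,
      iff_false, not_and, not_not]
    intro hy
    simpa using (extChartAt (𝓡 n) c).map_target hy
  rw [this, Measure.restrict_empty, lintegral_zero_measure]

/-- In the domain of a chart, the Riemannian volume is the volume of this chart. -/
theorem riemVolume_restrict_source (c : M) :
    (riemVolume n M).restrict (chartAt (EuclideanSpace ℝ (Fin n)) c).source
      = chartVolume (n := n) c := by
  set U := (chartAt (EuclideanSpace ℝ (Fin n)) c).source with hU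
  have hUm : MeasurableSet U := (chartAt _ c).open_source.measurableSet
  have hle : ∀ c' : M, chartVolume (n := n) c' ≤ riemVolume n M := fun c' ↦ le_iSup _ c'
  refine le_antisymm ?_ ?_
  · have h1 : riemVolume n M ≤ (riemVolume n M).restrict Uᶜ + chartVolume (n := n) c := by
      refine iSup_le fun c' ↦ Measure.le_iff.2 fun t ht ↦ ?_
      rw [← measure_inter_add_sdiff t hUm, add_comm, Measure.add_apply, Measure.restrict_apply ht]
      refine add_le_add (hle c' _) ?_
      set V := (chartAt (EuclideanSpace ℝ (Fin n)) c').source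
      have hVm : MeasurableSet V := (chartAt _ c').open_source.measurableSet
      rw [← measure_inter_add_sdiff (t ∩ U) hVm]
      have h0 : chartVolume (n := n) c' ((t ∩ U) \ V) = 0 :=
        measure_mono_null (fun x hx ↦ hx.2) (chartVolume_compl_source c')
      rw [h0, add_zero, chartVolume_eq_of_subset (c := c') (c' := c) ((ht.inter hUm).inter hVm)
        (fun x hx ↦ hx.2) (fun x hx ↦ hx.1.2)]
      exact measure_mono fun x hx ↦ hx.1.1
    refine Measure.le_iff.2 fun t ht ↦ ?_
    rw [Measure.restrict_apply ht]
    refine (h1 _).trans ?_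
    rw [Measure.add_apply, Measure.restrict_apply (ht.inter hUm)]
    have : t ∩ U ∩ Uᶜ = ∅ := by ext; simp
    rw [this, measure_empty, zero_add]
    exact measure_mono Set.inter_subset_left
  · refine Measure.le_iff.2 fun t ht ↦ ?_
    rw [Measure.restrict_apply ht, ← measure_inter_add_sdiff t hUm]
    have h0 : chartVolume (n := n) c (t \ U) = 0 :=
      measure_mono_null (fun x hx ↦ hx.2) (chartVolume_compl_source c)
    rw [h0, add_zero]
    exact hle c _

theorem coordDensity_nonneg (c x : M) : 0 ≤ coordDensity n c x := Real.sqrt_nonneg _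

/-- Integration in a chart, for functions that vanish off the domain of the chart. -/
theorem integral_eq_chart {c : M} {h : M → ℝ} (hc : Continuous h)
    (hs : ∀ x ∉ (chartAt (EuclideanSpace ℝ (Fin n)) c).source, h x = 0) :
    ∫ x, h x ∂(riemVolume n M) = ∫ y in (extChartAt (𝓡 n) c).target,
      coordDensity n c ((extChartAt (𝓡 n) c).symm y) * h ((extChartAt (𝓡 n) c).symm y) := by
  rw [← setIntegral_eq_integral_of_forall_compl_eq_zero hs, riemVolume_restrict_source,
    chartVolume_eq, integral_map
    ((aemeasurable_symm c).mono_ac (withDensity_absolutelyContinuous _ _))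
    hc.stronglyMeasurable.aestronglyMeasurable, integral_withDensity_eq_integral_toReal_smul₀
    _ (ae_of_all _ fun _ ↦ ENNReal.ofReal_lt_top)]
  · simp only [ENNReal.toReal_ofReal (coordDensity_nonneg _ _), smul_eq_mul]
  · exact ((contDiffOn_density c).continuousOn.aemeasurable
      (isOpen_target c).measurableSet).ennreal_ofReal

instance isLocallyFiniteMeasure_riemVolume : IsLocallyFiniteMeasure (riemVolume n M) := by
  refine ⟨fun x ↦ ?_⟩
  set U := (chartAt (EuclideanSpace ℝ (Fin n)) x).source
  obtain ⟨r, hr, hb⟩ := Metric.nhds_basis_closedBall.mem_iff.1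
    (extChartAt_target_mem_nhds (I := 𝓡 n) x)
  refine ⟨U ∩ extChartAt (𝓡 n) x ⁻¹' Metric.closedBall (extChartAt (𝓡 n) x x) r, ?_, ?_⟩
  · exact inter_mem (chart_source_mem_nhds _ x)
      (continuousAt_extChartAt x (Metric.closedBall_mem_nhds _ hr))
  · have hm : MeasurableSet (U ∩ extChartAt (𝓡 n) x ⁻¹'
        Metric.closedBall (extChartAt (𝓡 n) x x) r) := by
      have h := ((continuousOn_iff_continuous_domRestrict.1
        (continuousOn_extChartAt (I := 𝓡 n) x)).measurable
        (Metric.isClosed_closedBall (x := extChartAt (𝓡 n) x x) (ε := r)).measurableSet)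
      have := (isOpen_extChartAt_source (I := 𝓡 n) x).measurableSet.subtype_image h
      convert this using 1
      ext y; simp [U, and_comm]
    rw [← Set.inter_self U, Set.inter_assoc, Set.inter_comm,
      ← Measure.restrict_apply hm, riemVolume_restrict_source, chartVolume_apply x hm]
    have hint : IntegrableOn (coordDensity n x ∘ (extChartAt (𝓡 n) x).symm)
        (Metric.closedBall (extChartAt (𝓡 n) x x) r) :=
      ((contDiffOn_density x).continuousOn.mono hb).integrableOn_compact
        (isCompact_closedBall _ _)
    refine lt_of_le_of_lt ?_ hint.2
    refine (lintegral_mono_set ?_).trans (lintegral_mono fun y ↦ Real.ofReal_le_enorm _)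
    rintro y ⟨hy, -, hy'⟩
    rwa [Set.mem_preimage, (extChartAt (𝓡 n) x).right_inv hy] at hy'

end Coordinates

/-! ### Integration by parts against Lipschitz functions -/

/-- Integration by parts in `ℝⁿ` against a function `r` that is only Lipschitz: by Rademacher's
theorem `r` is differentiable almost everywhere, and `∫ r div z = - ∫ dr(z)`. The conclusion is
stated as a bound on the integral, in terms of a bound `b` for `|dr(z)|` at the points of
differentiability. -/
theorem abs_integral_mul_div_le {n : ℕ} {z : Fin n → EuclideanSpace ℝ (Fin n) → ℝ}
    (hz : ∀ i, ContDiff ℝ 1 (z i)) {K : Set (EuclideanSpace ℝ (Fin n))} (hK : IsCompact K)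
    (hzK : ∀ i, ∀ y ∉ K, z i y = 0) {r : EuclideanSpace ℝ (Fin n) → ℝ} {C : NNReal}
    (hr : LipschitzOnWith C r K) {b : EuclideanSpace ℝ (Fin n) → ℝ} (hb : Integrable b)
    (hb0 : ∀ y, 0 ≤ b y)
    (hbd : ∀ y ∈ K, DifferentiableAt ℝ r y →
      |∑ i, fderiv ℝ r y (EuclideanSpace.single i 1) * z i y| ≤ b y) :
    |∫ y, r y * ∑ i, fderiv ℝ (z i) y (EuclideanSpace.single i 1)| ≤ ∫ y, b y := by
  -- `r` is Lipschitz on `K` only; it is replaced by a Lipschitz function `f` on all of `ℝⁿ`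
  obtain ⟨f, hf, hfr⟩ := hr.extend_real
  have hcs : ∀ i, HasCompactSupport (z i) := fun i ↦ HasCompactSupport.intro hK (hzK i)
  have hts : ∀ i, tsupport (z i) ⊆ K := fun i ↦
    closure_minimal (fun y hy ↦ by by_contra h; exact hy (hzK i y h)) hK.isClosed
  have hL : ∀ i, ∃ D, LipschitzWith D (z i) := fun i ↦
    (hz i).lipschitzWith_of_hasCompactSupport (hcs i) one_ne_zero
  have hd0 : ∀ i, ∀ y ∉ K, fderiv ℝ (z i) y = 0 := fun i y hy ↦
    fderiv_of_notMem_tsupport ℝ fun h ↦ hy (hts i h)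
  have h1 : ∀ y, r y * ∑ i, fderiv ℝ (z i) y (EuclideanSpace.single i 1)
      = ∑ i, fderiv ℝ (z i) y (EuclideanSpace.single i 1) * f y := fun y ↦ by
    rw [← Finset.sum_mul, mul_comm]
    by_cases hy : y ∈ K
    · rw [hfr hy]
    · simp [hd0 _ y hy]
  have hd : ∀ i, Continuous fun y ↦ fderiv ℝ (z i) y (EuclideanSpace.single i 1) := fun i ↦
    ((hz i).continuous_fderiv one_ne_zero).clm_apply continuous_const
  have hi1 : ∀ i, Integrable fun y ↦ fderiv ℝ (z i) y (EuclideanSpace.single i 1) * f y := by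
    intro i
    refine ((hd i).mul hf.continuous).integrable_of_hasCompactSupport
      (HasCompactSupport.intro hK fun y hy ↦ ?_)
    simp [hd0 i y hy]
  have hi2 : ∀ i, ∫ y, fderiv ℝ (z i) y (EuclideanSpace.single i 1) * f y
      = - ∫ y, lineDeriv ℝ f y (EuclideanSpace.single i 1) * z i y := fun i ↦ by
    obtain ⟨D, hD⟩ := hL i
    rw [LipschitzWith.integral_lineDeriv_mul_eq hf hD (hcs i), ← integral_neg]
    congr 1
    ext y
    rw [((hz i).differentiable one_ne_zero y).lineDeriv_eq_fderiv, map_neg, neg_mul, neg_neg]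
  have hi3 : ∀ i, Integrable fun y ↦ lineDeriv ℝ f y (EuclideanSpace.single i 1) * z i y := by
    intro i
    have hm : AEStronglyMeasurable (fun y ↦ lineDeriv ℝ f y (EuclideanSpace.single i 1)) volume :=
      (measurable_lineDeriv hf.continuous).aestronglyMeasurable
    refine ((hz i).continuous.integrable_of_hasCompactSupport (hcs i)).bdd_mul hm
      (ae_of_all _ fun y ↦ ?_) (c := C * ‖(EuclideanSpace.single i (1 : ℝ))‖)
    exact norm_lineDeriv_le_of_lipschitz ℝ hf
  simp only [h1]
  rw [integral_finsetSum _ fun i _ ↦ hi1 i]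
  simp only [hi2]
  rw [Finset.sum_neg_distrib, abs_neg, ← integral_finsetSum _ fun i _ ↦ hi3 i, ← Real.norm_eq_abs]
  refine (norm_integral_le_integral_norm _).trans (integral_mono_ae
    (integrable_finsetSum _ fun i _ ↦ hi3 i).norm hb ?_)
  filter_upwards [hf.ae_differentiableAt (μ := volume)] with y hy
  rw [Real.norm_eq_abs]
  by_cases h0 : ∀ i, z i y = 0
  · simp [h0, hb0]
  · push Not at h0
    obtain ⟨i, hi⟩ := h0
    -- near `y` the extension `f` agrees with `r`, since `z i` is nonzero near `y`
    have hnear : f =ᶠ[𝓝 y] r := by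
      filter_upwards [(hz i).continuous.continuousAt.eventually_ne hi] with w hw
      exact (hfr (by by_contra h; exact hw (hzK i w h))).symm
    have hyK : y ∈ K := by by_contra h; exact hi (hzK i y h)
    have := hbd y hyK (hnear.differentiableAt_iff.1 hy)
    simpa only [hy.lineDeriv_eq_fderiv, hnear.fderiv_eq] using this

section Lipschitz

variable {n : ℕ} {M : Type*} [EMetricSpace M]
  [ChartedSpace (EuclideanSpace ℝ (Fin n)) M] [IsManifold (𝓡 n) ∞ M]
  [RiemannianBundle (fun x : M ↦ TangentSpace (𝓡 n) x)]
  [IsContMDiffRiemannianBundle (𝓡 n) ∞ (EuclideanSpace ℝ (Fin n))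
    (fun x : M ↦ TangentSpace (𝓡 n) x)]
  [IsRiemannianManifold (𝓡 n) M]

/-- The Riemannian distance of the end points of a coordinate segment is at most its length. -/
theorem edist_symm_le {c : M} {y v : EuclideanSpace ℝ (Fin n)} {B : ℝ}
    (h : ∀ s ∈ Set.Icc (0 : ℝ) 1, y + s • v ∈ (extChartAt (𝓡 n) c).target ∧
      ‖∑ i, v i • coordField c i ((extChartAt (𝓡 n) c).symm (y + s • v))‖ ≤ B) :
    edist ((extChartAt (𝓡 n) c).symm y) ((extChartAt (𝓡 n) c).symm (y + v))
      ≤ ENNReal.ofReal B := by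
  rw [IsRiemannianManifold.out (I := 𝓡 n)]
  set l : ℝ → EuclideanSpace ℝ (Fin n) := fun s ↦ y + s • v with hl
  have hld : ∀ t, HasDerivAt l v t := fun t ↦ by
    simpa only [one_smul, id] using ((hasDerivAt_id t).smul_const v).const_add y
  have hlc : ContDiff ℝ ∞ l := by fun_prop
  have hγ : ContMDiffOn 𝓘(ℝ, ℝ) (𝓡 n) 1 ((extChartAt (𝓡 n) c).symm ∘ l) (Set.Icc 0 1) := by
    refine ContMDiffOn.comp (contMDiffOn_extChartAt_symm c)
      ((hlc.contMDiff.of_le (by simp)).contMDiffOn) fun s hs ↦ (h s hs).1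
  refine (Manifold.riemannianEDist_le_pathELength hγ (by simp [l]) (by simp [l])
    zero_le_one).trans ?_
  rw [Manifold.pathELength_eq_lintegral_mfderiv_Ioo]
  have : ∀ t ∈ Set.Ioo (0 : ℝ) 1,
      ‖mfderiv 𝓘(ℝ, ℝ) (𝓡 n) ((extChartAt (𝓡 n) c).symm ∘ l) t 1‖ₑ ≤ ENNReal.ofReal B := by
    intro t ht
    obtain ⟨h1, h2⟩ := h t ⟨ht.1.le, ht.2.le⟩
    have h3 := mfderiv_comp t (mdifferentiableAt_symm h1) (hld t).differentiableAt.mdifferentiableAt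
    have h4 : (mfderiv 𝓘(ℝ, ℝ) 𝓘(ℝ, EuclideanSpace ℝ (Fin n)) l t (1 : ℝ) :
      EuclideanSpace ℝ (Fin n)) = v := by
      rw [mfderiv_eq_fderiv]; exact (fderiv_apply_one_eq_deriv).trans (hld t).deriv
    rw [← ofReal_norm]
    refine ENNReal.ofReal_le_ofReal ?_
    rw [← mfderiv_symm_apply h1] at h2
    refine le_trans (le_of_eq ?_) h2
    congr 1
    rw [h3]
    exact congrArg (mfderiv 𝓘(ℝ, EuclideanSpace ℝ (Fin n)) (𝓡 n) (extChartAt (𝓡 n) c).symm (l t)) h4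
  refine (setLIntegral_mono' measurableSet_Ioo this).trans ?_
  simp

theorem continuousOn_norm_coordField {c : M} (i : Fin n) : ContinuousOn
    (fun y ↦ ‖coordField c i ((extChartAt (𝓡 n) c).symm y)‖) (extChartAt (𝓡 n) c).target := by
  have h : ContinuousOn ((fun x ↦ coordGram n c x i i) ∘ (extChartAt (𝓡 n) c).symm)
      (extChartAt (𝓡 n) c).target :=
    (contDiffOn_comp_symm fun x hx ↦ contMDiffAt_coordGram hx i i).continuousOn
  refine h.sqrt.congr fun y hy ↦ ?_
  exact norm_eq_sqrt_real_inner _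

theorem continuousOn_norm_sum_coordField {c : M} (v : EuclideanSpace ℝ (Fin n)) : ContinuousOn
    (fun y ↦ ‖∑ i, v i • coordField c i ((extChartAt (𝓡 n) c).symm y)‖)
    (extChartAt (𝓡 n) c).target := by
  have h : ∀ i j, ContinuousOn ((fun x ↦ coordGram n c x i j) ∘ (extChartAt (𝓡 n) c).symm)
      (extChartAt (𝓡 n) c).target := fun i j ↦
    (contDiffOn_comp_symm fun x hx ↦ contMDiffAt_coordGram hx i j).continuousOn
  have h2 : ContinuousOn (fun y ↦ ∑ i, ∑ j, v i * (v j *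
      coordGram n c ((extChartAt (𝓡 n) c).symm y) i j)) (extChartAt (𝓡 n) c).target :=
    continuousOn_finsetSum _ fun i _ ↦ continuousOn_finsetSum _ fun j _ ↦
      continuousOn_const.mul (continuousOn_const.mul (h i j))
  refine h2.sqrt.congr fun y hy ↦ ?_
  simp only
  rw [norm_eq_sqrt_real_inner]
  congr 1
  simp only [sum_inner, inner_sum, real_inner_smul_left, real_inner_smul_right]
  refine Finset.sum_congr rfl fun i _ ↦ Finset.sum_congr rfl fun j _ ↦ ?_
  rw [real_inner_comm]
  rfl

/-- A Lipschitz function for the Riemannian distance is locally Lipschitz in charts. -/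
theorem locallyLipschitzOn_comp_symm {c : M} {ρ : M → ℝ} {ε : NNReal} (hρ : LipschitzWith ε ρ) :
    LocallyLipschitzOn (extChartAt (𝓡 n) c).target (ρ ∘ (extChartAt (𝓡 n) c).symm) := by
  intro y hy
  obtain ⟨δ, hδ, hb⟩ := Metric.nhds_basis_closedBall.mem_iff.1
    ((isOpen_target (n := n) c).mem_nhds hy)
  have hS : ContinuousOn (fun y ↦ ∑ i, ‖coordField c i ((extChartAt (𝓡 n) c).symm y)‖)
      (Metric.closedBall y δ) :=
    (continuousOn_finsetSum _ fun i _ ↦ continuousOn_norm_coordField i).mono hb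
  obtain ⟨B, hB⟩ := (isCompact_closedBall y δ).bddAbove_image hS
  have hB' : ∀ w ∈ Metric.closedBall y δ,
      ∑ i, ‖coordField c i ((extChartAt (𝓡 n) c).symm w)‖ ≤ B.toNNReal := fun w hw ↦
    (hB ⟨w, hw, rfl⟩).trans (Real.le_coe_toNNReal B)
  refine ⟨ε * B.toNNReal, Metric.closedBall y δ, mem_nhdsWithin_of_mem_nhds
    (Metric.closedBall_mem_nhds y hδ), fun w hw w' hw' ↦ ?_⟩
  refine (hρ _ _).trans ?_
  rw [ENNReal.coe_mul, mul_assoc]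
  gcongr
  have hseg : ∀ s ∈ Set.Icc (0 : ℝ) 1, w + s • (w' - w) ∈ Metric.closedBall y δ := fun s hs ↦
    (convex_closedBall y δ).add_smul_sub_mem hw hw' hs
  have := edist_symm_le (c := c) (y := w) (v := w' - w) (B := B.toNNReal * ‖w' - w‖) fun s hs ↦ by
    refine ⟨hb (hseg s hs), (norm_sum_le _ _).trans ?_⟩
    refine le_trans ?_ (mul_le_mul_of_nonneg_right (hB' _ (hseg s hs)) (norm_nonneg _))
    rw [Finset.sum_mul]
    refine Finset.sum_le_sum fun i _ ↦ ?_
    rw [norm_smul, mul_comm]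
    gcongr
    exact PiLp.norm_apply_le (w' - w) i
  rw [add_sub_cancel] at this
  refine this.trans (le_of_eq ?_)
  rw [ENNReal.ofReal_mul (by positivity), edist_comm, edist_dist, dist_eq_norm,
    ENNReal.ofReal_coe_nnreal]

/-- The differential of a function with Lipschitz constant `ε` for the Riemannian distance is
bounded by `ε` in the Riemannian norm, wherever it exists. -/
theorem abs_fderiv_le_of_lipschitz {c : M} {ρ : M → ℝ} {ε : NNReal} (hρ : LipschitzWith ε ρ)
    {y : EuclideanSpace ℝ (Fin n)} (hy : y ∈ (extChartAt (𝓡 n) c).target)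
    (hd : DifferentiableAt ℝ (ρ ∘ (extChartAt (𝓡 n) c).symm) y) (v : EuclideanSpace ℝ (Fin n)) :
    |fderiv ℝ (ρ ∘ (extChartAt (𝓡 n) c).symm) y v|
      ≤ ε * ‖∑ i, v i • coordField c i ((extChartAt (𝓡 n) c).symm y)‖ := by
  set r := ρ ∘ (extChartAt (𝓡 n) c).symm
  set N := fun y ↦ ‖∑ i, v i • coordField c i ((extChartAt (𝓡 n) c).symm y)‖ with hN
  refine le_of_forall_pos_le_add fun δ hδ ↦ ?_
  obtain ⟨η, hη, hηδ⟩ : ∃ η > 0, ε * η ≤ δ := by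
    refine ⟨δ / (ε + 1), by positivity, ?_⟩
    rw [mul_div_assoc', div_le_iff₀ (by positivity)]
    nlinarith [ε.2]
  have hl : HasDerivAt (fun t : ℝ ↦ r (y + t • v)) (fderiv ℝ r y v) 0 := by
    have h3 : HasDerivAt (fun t : ℝ ↦ y + t • v) v 0 := by
      simpa only [one_smul, id] using ((hasDerivAt_id (0 : ℝ)).smul_const v).const_add y
    exact HasFDerivAt.comp_hasDerivAt_of_eq 0 hd.hasFDerivAt h3 (by simp)
  have hev : ∀ᶠ w in 𝓝 y, w ∈ (extChartAt (𝓡 n) c).target ∧ N w < N y + η := by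
    have h1 := (isOpen_target (n := n) c).mem_nhds hy
    exact (eventually_mem_set.2 h1).and
      (((continuousOn_norm_sum_coordField v).continuousAt h1).eventually_lt continuousAt_const
        (lt_add_of_pos_right _ hη))
  obtain ⟨κ, hκ, hball⟩ := Metric.eventually_nhds_iff_ball.1 hev
  have hev2 : ∀ᶠ t in 𝓝 (0 : ℝ), y + t • v ∈ Metric.ball y κ := by
    have : ContinuousAt (fun t : ℝ ↦ y + t • v) 0 := by fun_prop
    exact this.eventually_mem (by simpa only [zero_smul, add_zero] using Metric.ball_mem_nhds y hκ)
  have := HasDerivAt.le_of_lip' (C := ε * (N y + η)) hl (by positivity) ?_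
  · rw [Real.norm_eq_abs] at this
    nlinarith
  · filter_upwards [hev2] with t ht
    simp only [zero_smul, add_zero, sub_zero]
    have hNy : 0 ≤ N y := norm_nonneg _
    have h1 := edist_symm_le (c := c) (y := y) (v := t • v) (B := (N y + η) * |t|) fun s hs ↦ by
      have hm : y + s • t • v ∈ Metric.ball y κ := by
        have := (convex_ball y κ).add_smul_sub_mem (Metric.mem_ball_self hκ) ht hs
        simpa using this
      obtain ⟨h1, h2⟩ := hball _ hm
      refine ⟨h1, ?_⟩
      have : ∑ i, (t • v) i • coordField c i ((extChartAt (𝓡 n) c).symm (y + s • t • v))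
          = t • ∑ i, v i • coordField c i ((extChartAt (𝓡 n) c).symm (y + s • t • v)) := by
        rw [Finset.smul_sum]
        refine Finset.sum_congr rfl fun i _ ↦ ?_
        rw [PiLp.smul_apply, smul_eq_mul, mul_smul]
      rw [this, norm_smul, Real.norm_eq_abs, mul_comm]
      gcongr
    rw [edist_comm] at h1
    have h2 := (hρ ((extChartAt (𝓡 n) c).symm (y + t • v)) ((extChartAt (𝓡 n) c).symm y)).trans
      (mul_le_mul_right h1 _)
    rw [edist_dist, ← ENNReal.ofReal_coe_nnreal, ← ENNReal.ofReal_mul ε.coe_nonneg,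
      ENNReal.ofReal_le_ofReal_iff (by positivity), Real.dist_eq] at h2
    rw [Real.norm_eq_abs, Real.norm_eq_abs, mul_assoc]
    exact h2

variable [MeasurableSpace M] [BorelSpace M]

theorem contDiffOn_density_mul_coeff {W : Π x : M, TangentSpace (𝓡 n) x} (hW : SmoothField W)
    (c : M) (i : Fin n) :
    ContDiffOn ℝ ∞ ((coordDensity n c * coordCoeff W c i) ∘ (extChartAt (𝓡 n) c).symm)
      (extChartAt (𝓡 n) c).target :=
  contDiffOn_comp_symm fun x hx ↦
    (contMDiffAt_coordDensity hx).mul (contMDiffAt_coordCoeff hx (hW x) i)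

/-- Continuity is read off from the coordinate formula `density_mul_divg`. -/
theorem continuous_divg {W : Π x : M, TangentSpace (𝓡 n) x} (hW : SmoothField W) :
    Continuous (divg W) := by
  rw [continuous_iff_continuousAt]
  intro c
  have hs := chart_source_mem_nhds (EuclideanSpace ℝ (Fin n)) c
  have hc := mem_chart_source (EuclideanSpace ℝ (Fin n)) c
  have h : (fun x ↦ (coordDensity n c x)⁻¹ * ∑ i,
      fderiv ℝ ((coordDensity n c * coordCoeff W c i) ∘ (extChartAt (𝓡 n) c).symm)
        (extChartAt (𝓡 n) c x) (EuclideanSpace.single i 1)) =ᶠ[𝓝 c] divg W := by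
    filter_upwards [hs] with x hx
    rw [← density_mul_divg hx (hW.diffFieldAt x), ← mul_assoc,
      inv_mul_cancel₀ (coordDensity_pos hx).ne', one_mul]
  refine ContinuousAt.congr (ContinuousAt.mul ?_ ?_) h
  · exact (contMDiffAt_coordDensity hc).continuousAt.inv₀ (coordDensity_pos hc).ne'
  · refine tendsto_finsetSum _ fun i _ ↦ ?_
    have h1 : ContinuousOn (fderiv ℝ ((coordDensity n c * coordCoeff W c i) ∘
        (extChartAt (𝓡 n) c).symm)) (extChartAt (𝓡 n) c).target :=
      (contDiffOn_density_mul_coeff hW c i).continuousOn_fderiv_of_isOpen (isOpen_target c)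
        (by simp)
    have h2 := (h1.continuousAt (extChartAt_target_mem_nhds c)).comp
      (f := extChartAt (𝓡 n) c) (continuousAt_extChartAt c)
    exact h2.clm_apply continuousAt_const

/-- Integration by parts against a Lipschitz function `ρ`, for a field `W` with compact support in
the domain of a chart: formally, `∫ ρ div W = - ∫ ⟨∇ρ, W⟩` with `|∇ρ| ≤ ε`. -/
theorem abs_integral_mul_divg_le_of_chart {c : M} {W : Π x : M, TangentSpace (𝓡 n) x}
    (hW : SmoothField W) {K : Set M} (hK : IsCompact K)
    (hKc : K ⊆ (chartAt (EuclideanSpace ℝ (Fin n)) c).source) (hWK : ∀ x ∉ K, W x = 0)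
    {ρ : M → ℝ} {ε : NNReal} (hρ : LipschitzWith ε ρ) :
    |∫ x, ρ x * divg W x ∂(riemVolume n M)| ≤ ε * ∫ x, ‖W x‖ ∂(riemVolume n M) := by
  classical
  set T := (extChartAt (𝓡 n) c).target with hT
  set ψ := (extChartAt (𝓡 n) c).symm with hψ
  have hTo : IsOpen T := isOpen_target c
  have hsrc : ∀ y ∈ T, ψ y ∈ (chartAt (EuclideanSpace ℝ (Fin n)) c).source := fun y hy ↦ by
    simpa only [extChartAt_source] using (extChartAt (𝓡 n) c).map_target hy
  set K' := extChartAt (𝓡 n) c '' K with hK'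
  have hK'c : IsCompact K' :=
    hK.image_of_continuousOn ((continuousOn_extChartAt c).mono (by simpa using hKc))
  have hK'T : K' ⊆ T := by
    rintro _ ⟨x, hx, rfl⟩; exact (extChartAt (𝓡 n) c).map_source (by simpa using hKc hx)
  have hW0 : ∀ y ∈ T, y ∉ K' → W (ψ y) = 0 := fun y hy hyK ↦ hWK _ fun h ↦
    hyK ⟨ψ y, h, (extChartAt (𝓡 n) c).right_inv hy⟩
  have hdW0 : ∀ x ∉ K, divg W x = 0 := fun x hx ↦ by
    have : W =ᶠ[𝓝 x] (0 : Π x : M, TangentSpace (𝓡 n) x) :=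
      eventuallyEq_of_mem (hK.isClosed.isOpen_compl.mem_nhds hx) hWK
    rw [divg_congr this (hW.diffFieldAt x), divg_zero]
  have ha0 : ∀ i, ∀ y ∈ T, y ∉ K' → coordCoeff W c i (ψ y) = 0 := fun i y hy hyK ↦ by
    rw [coordCoeff, hW0 y hy hyK, map_zero]
  -- the components of `√g W`, extended by zero
  set z : Fin n → EuclideanSpace ℝ (Fin n) → ℝ := fun i ↦
    T.indicator ((coordDensity n c * coordCoeff W c i) ∘ ψ) with hz
  have hzK : ∀ i, ∀ y ∉ K', z i y = 0 := fun i y hy ↦ by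
    by_cases hyT : y ∈ T
    · simp only [hz, Set.indicator_of_mem hyT, Function.comp_apply, Pi.mul_apply, ha0 i y hyT hy,
        mul_zero]
    · simp only [hz, Set.indicator_of_notMem hyT]
  have hzT : ∀ i, ∀ y ∈ T, z i =ᶠ[𝓝 y] (coordDensity n c * coordCoeff W c i) ∘ ψ := fun i y hy ↦
    eventuallyEq_of_mem (hTo.mem_nhds hy) fun w hw ↦ Set.indicator_of_mem hw _
  have hzd : ∀ i, ContDiff ℝ 1 (z i) := fun i ↦ by
    rw [contDiff_iff_contDiffAt]
    intro y
    by_cases hy : y ∈ K'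
    · have hyT := hTo.mem_nhds (hK'T hy)
      refine ContDiffAt.congr_of_eventuallyEq ?_ (hzT i y (hK'T hy))
      exact ((contDiffOn_density_mul_coeff hW c i).contDiffAt hyT).of_le (by simp)
    · refine contDiffAt_const (c := (0 : ℝ)) |>.congr_of_eventuallyEq ?_
      exact eventuallyEq_of_mem (hK'c.isClosed.isOpen_compl.mem_nhds hy) (hzK i)
  have hzdiff0 : ∀ i, ∀ y ∉ T, fderiv ℝ (z i) y = 0 := fun i y hy ↦ by
    have : z i =ᶠ[𝓝 y] fun _ ↦ (0 : ℝ) := eventuallyEq_of_mem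
      (hK'c.isClosed.isOpen_compl.mem_nhds fun h ↦ hy (hK'T h)) (hzK i)
    rw [this.fderiv_eq]; simp
  -- the integrand of `∫ ‖W‖` in the chart
  set b : EuclideanSpace ℝ (Fin n) → ℝ := T.indicator fun y ↦
    coordDensity n c (ψ y) * ‖W (ψ y)‖ with hb
  have hbi : Integrable b := by
    have h1 : ContinuousOn (fun y ↦ coordDensity n c (ψ y) * ‖W (ψ y)‖) T :=
      (contDiffOn_density c).continuousOn.mul
        ((hW.continuous_norm).comp_continuousOn (continuousOn_extChartAt_symm c))
    have h2 : IntegrableOn b K' :=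
      ((h1.mono hK'T).congr fun y hy ↦ Set.indicator_of_mem (hK'T hy) _).integrableOn_compact hK'c
    refine (integrableOn_iff_integrable_of_support_subset fun y hy ↦ ?_).1 h2
    by_contra hyK
    refine hy ?_
    by_cases hyT : y ∈ T
    · simp only [hb, Set.indicator_of_mem hyT, hW0 y hyT hyK, norm_zero, mul_zero]
    · simp only [hb, Set.indicator_of_notMem hyT]
  have hb0 : ∀ y, 0 ≤ b y := fun y ↦ Set.indicator_nonneg
    (fun y _ ↦ mul_nonneg (coordDensity_nonneg _ _) (norm_nonneg _)) y
  have hρc : Continuous ρ := hρ.continuous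
  obtain ⟨C, hC⟩ := ((locallyLipschitzOn_comp_symm (c := c) hρ).mono hK'T
    ).exists_lipschitzOnWith_of_compact hK'c
  have h1 : ∫ x, ρ x * divg W x ∂(riemVolume n M)
      = ∫ y, (ρ ∘ ψ) y * ∑ i, fderiv ℝ (z i) y (EuclideanSpace.single i 1) := by
    rw [integral_eq_chart (c := c) (h := fun x ↦ ρ x * divg W x)
      (hρc.mul (continuous_divg hW)) fun x hx ↦ by
      rw [hdW0 x fun h ↦ hx (hKc h), mul_zero], ← integral_indicator hTo.measurableSet]
    congr 1
    funext y
    by_cases hy : y ∈ T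
    · rw [Set.indicator_of_mem hy]
      have := density_mul_divg (hsrc y hy) (hW.diffFieldAt (ψ y))
      rw [(extChartAt (𝓡 n) c).right_inv hy] at this
      rw [mul_left_comm, this]
      congr 1
      refine Finset.sum_congr rfl fun i _ ↦ ?_
      rw [(hzT i y hy).fderiv_eq]
    · rw [Set.indicator_of_notMem hy]
      simp [hzdiff0 _ y hy]
  have h2 : ∫ x, ‖W x‖ ∂(riemVolume n M) = ∫ y, b y := by
    rw [integral_eq_chart (c := c) (hW.continuous_norm) fun x hx ↦ by
      rw [hWK x fun h ↦ hx (hKc h), norm_zero], ← integral_indicator hTo.measurableSet]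
  rw [h1, h2, ← integral_const_mul]
  refine abs_integral_mul_div_le hzd hK'c hzK hC (hbi.const_mul _)
    (fun y ↦ mul_nonneg ε.2 (hb0 y)) fun y hy hd ↦ ?_
  have hyT := hK'T hy
  have h3 := abs_fderiv_le_of_lipschitz hρ hyT hd (WithLp.toLp 2 fun i ↦ z i y)
  have h4 : fderiv ℝ (ρ ∘ ψ) y (WithLp.toLp 2 fun i ↦ z i y)
      = ∑ i, fderiv ℝ (ρ ∘ ψ) y (EuclideanSpace.single i 1) * z i y := by
    conv_lhs => rw [← (EuclideanSpace.basisFun (Fin n) ℝ).sum_repr (WithLp.toLp 2 fun i ↦ z i y)]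
    rw [map_sum]
    refine Finset.sum_congr rfl fun i _ ↦ ?_
    rw [map_smul, smul_eq_mul, mul_comm]
    simp
  rw [h4] at h3
  refine h3.trans (le_of_eq ?_)
  congr 1
  have h5 : ∑ i, (WithLp.toLp 2 fun i ↦ z i y : EuclideanSpace ℝ (Fin n)) i • coordField c i (ψ y)
      = coordDensity n c (ψ y) • W (ψ y) := by
    rw [eq_sum_coordCoeff W (hsrc y hyT), Finset.smul_sum]
    refine Finset.sum_congr rfl fun i _ ↦ ?_
    rw [smul_smul]
    simp only [hz, Set.indicator_of_mem hyT]
    rfl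
  rw [hb, Set.indicator_of_mem hyT, h5, norm_smul, Real.norm_of_nonneg (coordDensity_nonneg _ _)]

end Lipschitz

/-! ### The Hopf–Rinow theorem and cutoff functions -/

/-- The Riemannian distance is a length distance: a point at distance `a` from `x` is found on a
curve from `x` to `y` of length less than `a + b`. -/
theorem exists_edist_le_of_edist_lt_add (n : ℕ) {M : Type*} [EMetricSpace M]
    [ChartedSpace (EuclideanSpace ℝ (Fin n)) M]
    [RiemannianBundle (fun x : M ↦ TangentSpace (𝓡 n) x)] [IsManifold (𝓡 n) ∞ M]
    [IsRiemannianManifold (𝓡 n) M] {x y : M} {a b : ℝ≥0∞}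
    (h : edist x y < a + b) : ∃ z, edist x z ≤ a ∧ edist z y ≤ b := by
  rcases le_or_gt (edist x y) a with h1 | h1
  · exact ⟨y, h1, by simp⟩
  rw [IsRiemannianManifold.out (I := 𝓡 n)] at h
  obtain ⟨γ, h0, h1', hγ, hl⟩ := Manifold.exists_lt_of_riemannianEDist_lt h
  have hc : ContinuousOn (fun t ↦ edist x (γ t)) (Set.Icc 0 1) :=
    (continuous_const.edist continuous_id).comp_continuousOn hγ.continuousOn
  obtain ⟨t, ht, hta⟩ := intermediate_value_Icc zero_le_one hc
    (show a ∈ Set.Icc (edist x (γ 0)) (edist x (γ 1)) from by rw [h0, h1']; simp [h1.le])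
  refine ⟨γ t, hta.le, ?_⟩
  have e1 : a ≤ Manifold.pathELength (𝓡 n) γ 0 t := by
    rw [← show edist x (γ t) = a from hta, IsRiemannianManifold.out (I := 𝓡 n)]
    exact Manifold.riemannianEDist_le_pathELength (hγ.mono (Set.Icc_subset_Icc_right ht.2))
      h0 rfl ht.1
  have e2 : edist (γ t) y ≤ Manifold.pathELength (𝓡 n) γ t 1 := by
    rw [IsRiemannianManifold.out (I := 𝓡 n)]
    exact Manifold.riemannianEDist_le_pathELength (hγ.mono (Set.Icc_subset_Icc_left ht.1))
      rfl h1' ht.2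
  rw [← Manifold.pathELength_add ht.1 ht.2] at hl
  have ha : a ≠ ⊤ := (h1.trans_le le_top).ne
  refine e2.trans (le_of_lt ?_)
  exact (ENNReal.add_lt_add_iff_left ha).1 (lt_of_le_of_lt (add_le_add_left e1 _) hl)

/-- The Hopf–Rinow theorem: in a complete Riemannian manifold, closed balls of finite radius are
compact. -/
theorem isCompact_closedEBall (n : ℕ) {M : Type*} [EMetricSpace M] [CompleteSpace M]
    [ChartedSpace (EuclideanSpace ℝ (Fin n)) M]
    [RiemannianBundle (fun x : M ↦ TangentSpace (𝓡 n) x)] [IsManifold (𝓡 n) ∞ M]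
    [IsRiemannianManifold (𝓡 n) M] (x : M) (r : NNReal) :
    IsCompact (Metric.closedEBall x (r : ℝ≥0∞)) := by
  have : LocallyCompactSpace M := ChartedSpace.locallyCompactSpace (EuclideanSpace ℝ (Fin n)) M
  -- the radii for which the ball is compact form an initial segment which is open and closed
  set I : Set NNReal := {r | IsCompact (Metric.closedEBall x (r : ℝ≥0∞))} with hI
  have hmono : ∀ r ∈ I, ∀ s ≤ r, s ∈ I := fun r hr s hs ↦
    hr.of_isClosed_subset Metric.isClosed_closedEBall
      (Metric.closedEBall_subset_closedEBall (by exact_mod_cast hs))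
  have h0 : (0 : NNReal) ∈ I := by
    simp only [hI, Set.mem_ofPred_eq, ENNReal.coe_zero, Metric.closedEBall_zero]
    exact isCompact_singleton
  have hopen : ∀ r ∈ I, ∃ δ > 0, r + δ ∈ I := by
    intro r hr
    obtain ⟨K', hK', hKK'⟩ := exists_compact_superset
      (show IsCompact (Metric.closedEBall x (r : ℝ≥0∞)) from hr)
    obtain ⟨δ, hδ, hth⟩ := IsCompact.exists_thickening_subset_open
      (show IsCompact (Metric.closedEBall x (r : ℝ≥0∞)) from hr) isOpen_interior hKK'
    lift δ to NNReal using hδ.le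
    have hδ' : 0 < δ := by exact_mod_cast hδ
    refine ⟨δ / 4, by positivity, hK'.of_isClosed_subset Metric.isClosed_closedEBall
      fun y hy ↦ interior_subset (hth ?_)⟩
    rw [Metric.mem_closedEBall, edist_comm] at hy
    have h4 : δ / 4 < δ / 2 := by
      rw [← NNReal.coe_lt_coe]; push_cast; linarith
    have h2 : δ / 2 < δ := NNReal.half_lt_self hδ'.ne'
    obtain ⟨z, hz1, hz2⟩ := exists_edist_le_of_edist_lt_add n (a := r) (b := (δ / 2 : NNReal))
      (lt_of_le_of_lt hy (by exact_mod_cast add_lt_add_right h4 r))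
    rw [Metric.mem_thickening_iff_infEDist_lt]
    refine lt_of_le_of_lt (Metric.infEDist_le_edist_of_mem
      (show z ∈ Metric.closedEBall x (r : ℝ≥0∞) by rwa [Metric.mem_closedEBall, edist_comm])) ?_
    rw [edist_comm, ENNReal.ofReal_coe_nnreal]
    exact lt_of_le_of_lt hz2 (by exact_mod_cast h2)
  have hclosed : ∀ r, 0 < r → (∀ s < r, s ∈ I) → r ∈ I := by
    intro r hr hs
    refine TotallyBounded.isCompact_of_isClosed (EMetric.totallyBounded_iff.2 fun ε hε ↦ ?_)
      Metric.isClosed_closedEBall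
    obtain ⟨η, hη, hηε⟩ := ENNReal.lt_iff_exists_nnreal_btwn.1 hε
    have hη0 : 0 < η := by exact_mod_cast hη
    have hlt : r - η / 3 < r := tsub_lt_self hr (by positivity)
    obtain ⟨t, ht, hcov⟩ := EMetric.totallyBounded_iff.1
      (show IsCompact (Metric.closedEBall x ((r - η / 3 : NNReal) : ℝ≥0∞)) from
        hs _ hlt).totallyBounded
      ((η / 3 : NNReal) : ℝ≥0∞) (by exact_mod_cast (show 0 < η / 3 by positivity))
    refine ⟨t, ht, fun y hy ↦ ?_⟩
    rw [Metric.mem_closedEBall, edist_comm] at hy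
    have hlt2 : r < (r - η / 3) + 2 * (η / 3) := by
      have h1 : r ≤ (r - η / 3) + η / 3 := le_tsub_add
      refine lt_of_le_of_lt h1 ?_
      gcongr
      have : 0 < η / 3 := by positivity
      rw [two_mul]; exact lt_add_of_pos_right _ this
    obtain ⟨z, hz1, hz2⟩ := exists_edist_le_of_edist_lt_add n
      (a := (r - η / 3 : NNReal)) (b := (2 * (η / 3) : NNReal))
      (lt_of_le_of_lt hy (by exact_mod_cast hlt2))
    obtain ⟨w, hw, hzw⟩ := Set.mem_iUnion₂.1
      (hcov (show z ∈ Metric.closedEBall x _ by rwa [Metric.mem_closedEBall, edist_comm]))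
    refine Set.mem_iUnion₂.2 ⟨w, hw, ?_⟩
    rw [Metric.mem_eball] at hzw ⊢
    refine lt_of_le_of_lt (edist_triangle y z w) ?_
    rw [edist_comm y z]
    refine lt_trans (ENNReal.add_lt_add_of_le_of_lt
      (hz2.trans_lt ENNReal.coe_lt_top).ne hz2 hzw) ?_
    refine lt_of_le_of_lt (le_of_eq ?_) hηε
    norm_cast
    rw [← NNReal.coe_inj]; push_cast; ring
  by_contra hr
  have hbdd : BddAbove I := ⟨r, fun s hs ↦ by
    by_contra h; exact hr (hmono s hs r (not_le.1 h).le)⟩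
  have hlt : ∀ s < sSup I, s ∈ I := fun s hs ↦ by
    obtain ⟨u, hu, hsu⟩ := exists_lt_of_lt_csSup ⟨0, h0⟩ hs
    exact hmono u hu s hsu.le
  have hmem : sSup I ∈ I := by
    rcases eq_or_lt_of_le ((zero_le : 0 ≤ sSup I)) with h | h
    · rwa [← h]
    · exact hclosed _ h hlt
  obtain ⟨δ, hδ, hδI⟩ := hopen _ hmem
  exact absurd (le_csSup hbdd hδI) (not_le.2 (lt_add_of_pos_right _ hδ))

/-- Cutoff functions with small Lipschitz constants on a complete Riemannian manifold. They are
functions of the distance to finitely many points of a dense sequence: `M` need not be connected,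
so that a single point may be at infinite distance from other points. -/
theorem exists_cutoff (n : ℕ) {M : Type*} [EMetricSpace M] [CompleteSpace M]
    [SecondCountableTopology M] [ChartedSpace (EuclideanSpace ℝ (Fin n)) M]
    [RiemannianBundle (fun x : M ↦ TangentSpace (𝓡 n) x)] [IsManifold (𝓡 n) ∞ M]
    [IsRiemannianManifold (𝓡 n) M] :
    ∃ ρ : ℕ → M → ℝ, (∀ k : ℕ, LipschitzWith ((k : NNReal) + 1)⁻¹ (ρ k)) ∧ (∀ k x, |ρ k x| ≤ 1) ∧
      (∀ k, HasCompactSupport (ρ k)) ∧ ∀ x, Tendsto (fun k ↦ ρ k x) atTop (𝓝 1) := by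
  rcases isEmpty_or_nonempty M with hM | hM
  · exact ⟨fun _ _ ↦ 0, fun k x ↦ isEmptyElim x, fun k x ↦ isEmptyElim x,
      fun k ↦ HasCompactSupport.zero, fun x ↦ isEmptyElim x⟩
  set p := TopologicalSpace.denseSeq M
  set d : ℕ → M → ℝ≥0∞ := fun k x ↦ Metric.infEDist x (p '' Set.Iic k)
  set c : ℕ → ℝ≥0∞ := fun k ↦ ((2 * ((k : ℕ) + 1) : NNReal) : ℝ≥0∞) with hc
  -- the truncation at `2 (k + 1)`, beyond which the cutoff vanishes, makes the distance finite
  set t : ℕ → M → ℝ := fun k x ↦ (min (d k x) (c k)).toReal with ht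
  have hfin : ∀ k x, min (d k x) (c k) ≠ ⊤ := fun k x ↦
    ((min_le_right _ _).trans_lt ENNReal.coe_lt_top).ne
  have ht0 : ∀ k x, 0 ≤ t k x := fun k x ↦ ENNReal.toReal_nonneg
  have hcr : ∀ k, (c k).toReal = 2 * (k + 1) := fun k ↦ by
    show ((2 * ((k : ℕ) + 1) : NNReal) : ℝ) = _
    push_cast
    rfl
  have htc : ∀ k x, t k x ≤ 2 * (k + 1) := fun k x ↦ by
    refine (ENNReal.toReal_mono ENNReal.coe_ne_top (min_le_right _ _)).trans_eq (hcr k)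
  have htl : ∀ k : ℕ, LipschitzWith 1 (t k) := fun k x y ↦ by
    rw [ENNReal.coe_one, one_mul]
    by_cases h : edist x y = ⊤
    · rw [h]; exact le_top
    have key : ∀ x y : M, edist x y ≠ ⊤ → t k x ≤ t k y + (edist x y).toReal := fun x y h ↦ by
      simp only [ht]
      rw [← ENNReal.toReal_add (hfin k y) h]
      refine ENNReal.toReal_mono (ENNReal.add_ne_top.2 ⟨hfin k y, h⟩) ?_
      rw [min_add]
      exact min_le_min Metric.infEDist_le_infEDist_add_edist le_self_add
    rw [edist_dist, ← ENNReal.ofReal_toReal h]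
    refine ENNReal.ofReal_le_ofReal ?_
    rw [Real.dist_eq, abs_sub_le_iff]
    have h1 := key x y h
    have h2 := key y x (by rwa [edist_comm])
    rw [edist_comm y x] at h2
    constructor <;> linarith
  refine ⟨fun k x ↦ min 1 (2 - t k x / (k + 1)), fun (k : ℕ) ↦ ?_, fun k x ↦ ?_, fun k ↦ ?_,
    fun x ↦ ?_⟩
  · refine LipschitzWith.const_min (f := fun x ↦ 2 - t k x / (k + 1)) ?_ 1
    have h1 : LipschitzWith ((k : NNReal) + 1)⁻¹ fun u : ℝ ↦ 2 - u / (k + 1) := by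
      refine LipschitzWith.of_dist_le_mul fun u v ↦ le_of_eq ?_
      rw [Real.dist_eq, Real.dist_eq]
      have : (2 - u / (k + 1) - (2 - v / (k + 1)) : ℝ) = -(((k : ℝ) + 1)⁻¹ * (u - v)) := by ring
      rw [this, abs_neg, abs_mul, abs_of_nonneg (by positivity)]
      push_cast
      rfl
    have h2 := h1.comp (htl k)
    rw [mul_one] at h2
    exact h2
  · have h1 : 0 ≤ 2 - t k x / (k + 1) := by
      rw [sub_nonneg, div_le_iff₀ (by positivity)]; exact htc k x
    rw [abs_le]
    exact ⟨by linarith [le_min zero_le_one h1], min_le_left _ _⟩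
  · refine HasCompactSupport.intro (K := ⋃ i ∈ Set.Iic k, Metric.closedEBall (p i) (c k))
      ((Set.finite_Iic k).isCompact_biUnion fun i _ ↦ isCompact_closedEBall n _ _) fun x hx ↦ ?_
    have h1 : c k ≤ d k x := by
      refine Metric.le_infEDist.2 ?_
      rintro _ ⟨i, hi, rfl⟩
      by_contra h
      exact hx (Set.mem_iUnion₂.2 ⟨i, hi, (not_le.1 h).le⟩)
    have h2 : t k x = 2 * (k + 1) := by
      simp only [ht, min_eq_right h1, hcr]
    simp only [h2]
    rw [mul_div_assoc, div_self (by positivity)]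
    norm_num
  · obtain ⟨_, ⟨i, rfl⟩, hi⟩ := EMetric.mem_closure_iff.1
      ((TopologicalSpace.denseRange_denseSeq M).closure_eq ▸ Set.mem_univ x :
        x ∈ closure (Set.range p)) 1 one_pos
    refine tendsto_const_nhds.congr' ?_
    filter_upwards [eventually_ge_atTop i] with k hk
    have h1 : t k x ≤ 1 := by
      have : min (d k x) (c k) ≤ 1 := (min_le_left _ _).trans
        ((Metric.infEDist_le_edist_of_mem (Set.mem_image_of_mem p (Set.mem_Iic.2 hk))).trans hi.le)
      simpa using ENNReal.toReal_mono ENNReal.one_ne_top this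
    refine (min_eq_left ?_).symm
    have : t k x / (k + 1) ≤ 1 := by
      rw [div_le_iff₀ (by positivity)]
      linarith [(Nat.cast_nonneg k : (0 : ℝ) ≤ k)]
    linarith

/-! ### The divergence theorem on complete manifolds -/

section Divergence

variable {n : ℕ} {M : Type*} [EMetricSpace M]
  [ChartedSpace (EuclideanSpace ℝ (Fin n)) M] [IsManifold (𝓡 n) ∞ M]
  [RiemannianBundle (fun x : M ↦ TangentSpace (𝓡 n) x)]
  [IsContMDiffRiemannianBundle (𝓡 n) ∞ (EuclideanSpace ℝ (Fin n))
    (fun x : M ↦ TangentSpace (𝓡 n) x)]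
  [IsRiemannianManifold (𝓡 n) M]

variable [SecondCountableTopology M] [MeasurableSpace M] [BorelSpace M]

/-- Integration by parts against a compactly supported Lipschitz function. A partition of unity
cuts the field into pieces that are supported in single charts; as the estimate in a chart does not
involve derivatives of the partition functions, the pieces add up to the same bound. -/
theorem abs_integral_mul_divg_le {W : Π x : M, TangentSpace (𝓡 n) x}
    (hW : SmoothField W) (hWi : Integrable (fun x ↦ ‖W x‖) (riemVolume n M))
    {ρ : M → ℝ} {ε : NNReal} (hρ : LipschitzWith ε ρ) (hρc : HasCompactSupport ρ) :
    |∫ x, ρ x * divg W x ∂(riemVolume n M)| ≤ ε * ∫ x, ‖W x‖ ∂(riemVolume n M) := by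
  have : LocallyCompactSpace M := ChartedSpace.locallyCompactSpace (EuclideanSpace ℝ (Fin n)) M
  obtain ⟨K', hK', hKK'⟩ := exists_compact_superset (show IsCompact (tsupport ρ) from hρc)
  have hN : ∀ c : M, ∃ N : Set M, IsCompact N ∧ c ∈ interior N ∧
      N ⊆ (chartAt (EuclideanSpace ℝ (Fin n)) c).source := fun c ↦
    exists_compact_subset (chartAt _ c).open_source (mem_chart_source _ c)
  choose N hNc hNi hNs using hN
  obtain ⟨f, hf⟩ := SmoothPartitionOfUnity.exists_isSubordinate (𝓡 n) (isClosed_univ (X := M))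
    (fun c ↦ interior (N c)) (fun _ ↦ isOpen_interior)
    (fun x _ ↦ Set.mem_iUnion.2 ⟨x, hNi x⟩)
  -- near the support of `ρ`, the sum of the partition functions with index in `S` is `1`
  set S : Finset M := (f.locallyFinite.finite_nonempty_inter_compact hK').toFinset with hS
  have hsum : ∀ x ∈ K', ∑ i ∈ S, f i x = 1 := fun x hx ↦
    f.sum_finsupport' x (Set.mem_univ x) fun i hi ↦ by
      rw [hS, Set.Finite.mem_toFinset]
      exact ⟨x, by simpa using hi, hx⟩
  have hsum1 : ∀ x, ∑ i ∈ S, f i x ≤ 1 := fun x ↦ by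
    classical
    rw [← f.sum_finsupport' x (Set.mem_univ x) (Finset.subset_union_right (s₁ := S))]
    exact Finset.sum_le_sum_of_subset_of_nonneg Finset.subset_union_left
      fun i _ _ ↦ f.nonneg i x
  let Wi : M → Π x : M, TangentSpace (𝓡 n) x := fun i ↦ (f i : M → ℝ) • W
  have hWis : ∀ i, SmoothField (Wi i) := fun i ↦ (f i).contMDiff.smul_section hW
  have hcont : Continuous ρ := hρ.continuous
  have hint : ∀ i ∈ S, Integrable (fun x ↦ ρ x * divg (Wi i) x) (riemVolume n M) := fun i _ ↦
    (hcont.mul (continuous_divg (hWis i))).integrable_of_hasCompactSupport hρc.mul_right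
  have hpt : ∀ x, ρ x * divg W x = ∑ i ∈ S, ρ x * divg (Wi i) x := fun x ↦ by
    by_cases hx : x ∈ tsupport ρ
    · rw [← Finset.mul_sum, ← (divg_sum S fun i _ ↦ (hWis i).diffFieldAt x).2]
      congr 1
      refine divg_congr ?_ (hW.diffFieldAt x)
      refine eventuallyEq_of_mem (mem_interior_iff_mem_nhds.1 (hKK' hx)) fun y hy ↦ ?_
      show W y = (∑ i ∈ S, Wi i) y
      rw [Finset.sum_apply]
      show W y = ∑ i ∈ S, f i y • W y
      rw [← Finset.sum_smul, hsum y hy, one_smul]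
    · simp [image_eq_zero_of_notMem_tsupport hx]
  have hWin : ∀ i x, ‖Wi i x‖ = f i x * ‖W x‖ := fun i x ↦ by
    show ‖f i x • W x‖ = _
    rw [norm_smul, Real.norm_of_nonneg (f.nonneg i x)]
  have hWii : ∀ i ∈ S, Integrable (fun x ↦ ‖Wi i x‖) (riemVolume n M) := fun i _ ↦
    hWi.mono ((hWis i).continuous_norm).stronglyMeasurable.aestronglyMeasurable
      (ae_of_all _ fun x ↦ by
        rw [norm_norm, norm_norm, hWin]
        exact mul_le_of_le_one_left (norm_nonneg _) (f.le_one i x))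
  calc |∫ x, ρ x * divg W x ∂(riemVolume n M)|
      = |∑ i ∈ S, ∫ x, ρ x * divg (Wi i) x ∂(riemVolume n M)| := by
        rw [← integral_finsetSum S hint]
        simp only [hpt]
    _ ≤ ∑ i ∈ S, ε * ∫ x, ‖Wi i x‖ ∂(riemVolume n M) := by
        refine (Finset.abs_sum_le_sum_abs _ _).trans (Finset.sum_le_sum fun i _ ↦ ?_)
        refine abs_integral_mul_divg_le_of_chart (c := i) (hWis i)
          ((hNc i).of_isClosed_subset (isClosed_tsupport _) ((hf i).trans interior_subset))
          (((hf i).trans interior_subset).trans (hNs i)) (fun x hx ↦ ?_) hρ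
        show f i x • W x = 0
        rw [image_eq_zero_of_notMem_tsupport hx, zero_smul]
    _ = ε * ∫ x, ∑ i ∈ S, ‖Wi i x‖ ∂(riemVolume n M) := by
        rw [integral_finsetSum S hWii, Finset.mul_sum]
    _ ≤ ε * ∫ x, ‖W x‖ ∂(riemVolume n M) := by
        refine mul_le_mul_of_nonneg_left (integral_mono (integrable_finsetSum S hWii) hWi
          fun x ↦ ?_) ε.coe_nonneg
        simp only [hWin, ← Finset.sum_mul]
        exact mul_le_of_le_one_left (norm_nonneg _) (hsum1 x)

/-- Gaffney's divergence theorem: on a complete Riemannian manifold, the divergence of an integrable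
smooth field has integral zero if it is integrable. -/
theorem integral_divg_eq_zero [CompleteSpace M] {W : Π x : M, TangentSpace (𝓡 n) x}
    (hW : SmoothField W) (hWi : Integrable (fun x ↦ ‖W x‖) (riemVolume n M))
    (hd : Integrable (divg W) (riemVolume n M)) :
    ∫ x, divg W x ∂(riemVolume n M) = 0 := by
  obtain ⟨ρ, hlip, hle, hsupp, hlim⟩ := exists_cutoff n (M := M)
  have h1 : Tendsto (fun k ↦ ∫ x, ρ k x * divg W x ∂(riemVolume n M)) atTop
      (𝓝 (∫ x, divg W x ∂(riemVolume n M))) := by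
    refine tendsto_integral_of_dominated_convergence (fun x ↦ |divg W x|)
      (fun k ↦ ((hlip k).continuous.mul
        (continuous_divg hW)).stronglyMeasurable.aestronglyMeasurable)
      hd.abs (fun k ↦ ae_of_all _ fun x ↦ ?_) (ae_of_all _ fun x ↦ ?_)
    · rw [Real.norm_eq_abs, abs_mul]
      exact mul_le_of_le_one_left (abs_nonneg _) (hle k x)
    · simpa using (hlim x).mul_const (divg W x)
  have h2 : Tendsto (fun k : ℕ ↦ ((((k : NNReal) + 1)⁻¹ : NNReal) : ℝ) *
      ∫ x, ‖W x‖ ∂(riemVolume n M)) atTop (𝓝 0) := by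
    have := (tendsto_one_div_add_atTop_nhds_zero_nat (𝕜 := ℝ)).mul_const
      (∫ x, ‖W x‖ ∂(riemVolume n M))
    simpa using this
  exact tendsto_nhds_unique h1 (squeeze_zero_norm
    (fun k ↦ abs_integral_mul_divg_le hW hWi (hlip k) (hsupp k)) h2)

end Divergence

/-! ### Convergence in `L²` -/

section L2

variable {α : Type*} [MeasurableSpace α] {μ : Measure α}

theorem eLpNorm_two_eq (f : α → ℝ) : eLpNorm f 2 μ = (∫⁻ x, ‖f x‖ₑ ^ 2 ∂μ) ^ (2⁻¹ : ℝ) := by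
  have h := eLpNorm_nnreal_pow_eq_lintegral (μ := μ) (f := f) (p := 2) (by simp)
  simp only [NNReal.coe_ofNat, ENNReal.coe_ofNat, ENNReal.rpow_ofNat] at h
  rw [← h, ← ENNReal.rpow_natCast, ← ENNReal.rpow_mul]
  norm_num

theorem memLp_two_of_lintegral_lt_top {f : α → ℝ} (hf : AEStronglyMeasurable f μ)
    (h : ∫⁻ x, ‖f x‖ₑ ^ 2 ∂μ < ⊤) : MemLp f 2 μ := by
  refine ⟨hf, ?_⟩
  rw [eLpNorm_two_eq]
  exact ENNReal.rpow_lt_top_of_nonneg (by norm_num) h.ne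

theorem tendsto_eLpNorm_two {f : ℕ → α → ℝ}
    (h : Tendsto (fun j ↦ ∫⁻ x, ‖f j x‖ₑ ^ 2 ∂μ) atTop (𝓝 0)) :
    Tendsto (fun j ↦ eLpNorm (f j) 2 μ) atTop (𝓝 0) := by
  simp only [eLpNorm_two_eq]
  have := (ENNReal.continuous_rpow_const (y := (2⁻¹ : ℝ))).continuousAt.tendsto.comp h
  simpa [Function.comp_def] using this

/-- An `L²` limit of `L²` functions belongs to `L²`. -/
theorem memLp_two_of_tendsto {a : ℕ → α → ℝ} {A : α → ℝ} (ha : ∀ j, MemLp (a j) 2 μ)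
    (hA : AEStronglyMeasurable A μ)
    (h : Tendsto (fun j ↦ ∫⁻ x, ‖a j x - A x‖ₑ ^ 2 ∂μ) atTop (𝓝 0)) : MemLp A 2 μ := by
  obtain ⟨j, hj⟩ := (h.eventually (gt_mem_nhds one_pos)).exists
  have h1 : MemLp (fun x ↦ a j x - A x) 2 μ :=
    memLp_two_of_lintegral_lt_top ((ha j).1.sub hA) (hj.trans ENNReal.one_lt_top)
  exact ((ha j).sub h1).ae_eq (ae_of_all _ fun x ↦ by simp)

/-- The integral of a product is continuous along `L²` convergent sequences of factors. -/
theorem tendsto_integral_mul {a b : ℕ → α → ℝ} {A B : α → ℝ} (ha : ∀ j, MemLp (a j) 2 μ)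
    (hb : ∀ j, MemLp (b j) 2 μ) (hA : MemLp A 2 μ) (hB : MemLp B 2 μ)
    (h : Tendsto (fun j ↦ ∫⁻ x, ‖a j x - A x‖ₑ ^ 2 ∂μ) atTop (𝓝 0))
    (h' : Tendsto (fun j ↦ ∫⁻ x, ‖b j x - B x‖ₑ ^ 2 ∂μ) atTop (𝓝 0)) :
    Tendsto (fun j ↦ ∫ x, a j x * b j x ∂μ) atTop (𝓝 (∫ x, A x * B x ∂μ)) := by
  have key : ∀ {f g : α → ℝ} (hf : MemLp f 2 μ) (hg : MemLp g 2 μ),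
      ∫ x, f x * g x ∂μ = inner ℝ (hf.toLp f) (hg.toLp g) := fun {f g} hf hg ↦ by
    rw [L2.inner_def]
    refine integral_congr_ae ?_
    filter_upwards [hf.coeFn_toLp, hg.coeFn_toLp] with x hx hx'
    rw [hx, hx', RCLike.inner_apply, conj_trivial, mul_comm]
  simp only [key hA hB, fun j ↦ key (ha j) (hb j)]
  exact ((Lp.tendsto_Lp_iff_tendsto_eLpNorm'' _ ha _ hA).2 (tendsto_eLpNorm_two h)).inner
    ((Lp.tendsto_Lp_iff_tendsto_eLpNorm'' _ hb _ hB).2 (tendsto_eLpNorm_two h'))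

end L2

/-! ### Functions of finite `H²` norm -/

section Sobolev

variable {n : ℕ} {M : Type*} [EMetricSpace M]
  [ChartedSpace (EuclideanSpace ℝ (Fin n)) M] [IsManifold (𝓡 n) ∞ M]
  [RiemannianBundle (fun x : M ↦ TangentSpace (𝓡 n) x)]
  [IsContMDiffRiemannianBundle (𝓡 n) ∞ (EuclideanSpace ℝ (Fin n))
    (fun x : M ↦ TangentSpace (𝓡 n) x)]
  [IsRiemannianManifold (𝓡 n) M]

theorem norm_energyField_le (u v : M → ℝ) (X : Π x : M, TangentSpace (𝓡 n) x) (x : M) :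
    ‖energyField u v X x‖ ≤ 3 * (‖X x‖ * (‖grad n u x‖ * ‖grad n v x‖)) := by
  have h1 := norm_add₃_le (a := inner ℝ (grad n u x) (X x) • grad n v x)
    (b := inner ℝ (grad n v x) (X x) • grad n u x)
    (c := (-inner ℝ (grad n u x) (grad n v x)) • X x)
  simp only [norm_smul, norm_neg] at h1
  have i1 := mul_le_mul_of_nonneg_right (norm_inner_le_norm (𝕜 := ℝ) (grad n u x) (X x))
    (norm_nonneg (grad n v x))
  have i2 := mul_le_mul_of_nonneg_right (norm_inner_le_norm (𝕜 := ℝ) (grad n v x) (X x))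
    (norm_nonneg (grad n u x))
  have i3 := mul_le_mul_of_nonneg_right (norm_inner_le_norm (𝕜 := ℝ) (grad n u x) (grad n v x))
    (norm_nonneg (X x))
  have h2 : ‖energyField u v X x‖ ≤ _ := h1
  refine h2.trans ?_
  linarith

/-- `|Δu|² ≤ n |∇²u|²`, as `Δu` is the trace of the Hessian. -/
theorem laplacian_sq_le (u : M → ℝ) (x : M) : laplacian n u x ^ 2 ≤ n * hessNormSq n u x := by
  have hn : Module.finrank ℝ (TangentSpace (𝓡 n) x) = n := by
    show Module.finrank ℝ (EuclideanSpace ℝ (Fin n)) = n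
    simp
  rw [laplacian, divg,
    LinearMap.trace_eq_sum_inner _ (stdOrthonormalBasis ℝ (TangentSpace (𝓡 n) x))]
  refine sq_sum_le_card_mul_sum_sq.trans ?_
  rw [Finset.card_univ, Fintype.card_fin, hessNormSq, congrArg (Nat.cast (R := ℝ)) hn]
  refine mul_le_mul_of_nonneg_left (Finset.sum_le_sum fun i _ ↦ ?_) (Nat.cast_nonneg n)
  exact Finset.single_le_sum (f := fun j ↦ hess n u x
    (stdOrthonormalBasis ℝ (TangentSpace (𝓡 n) x) i)
    (stdOrthonormalBasis ℝ (TangentSpace (𝓡 n) x) j) ^ 2)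
    (fun j _ ↦ sq_nonneg _) (Finset.mem_univ i)

theorem hessNormSq_nonneg (u : M → ℝ) (x : M) : 0 ≤ hessNormSq n u x :=
  Finset.sum_nonneg fun _ _ ↦ Finset.sum_nonneg fun _ _ ↦ sq_nonneg _

variable [SecondCountableTopology M] [MeasurableSpace M] [BorelSpace M]

theorem memLp_norm_grad {u : M → ℝ} (hu : ContMDiff (𝓡 n) 𝓘(ℝ, ℝ) ∞ u) (h : h2NormSq n u < ⊤) :
    MemLp (fun x ↦ ‖grad n u x‖) 2 (riemVolume n M) := by
  refine memLp_two_of_lintegral_lt_top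
    ((smoothField_grad hu).continuous_norm).stronglyMeasurable.aestronglyMeasurable
    (lt_of_le_of_lt (lintegral_mono fun x ↦ ?_) h)
  rw [Real.enorm_eq_ofReal (norm_nonneg _), ← ENNReal.ofReal_pow (norm_nonneg _)]
  refine ENNReal.ofReal_le_ofReal ?_
  linarith [sq_nonneg (u x), hessNormSq_nonneg (n := n) u x]

theorem memLp_laplacian {u : M → ℝ} (hu : ContMDiff (𝓡 n) 𝓘(ℝ, ℝ) ∞ u) (h : h2NormSq n u < ⊤) :
    MemLp (laplacian n u) 2 (riemVolume n M) := by
  refine memLp_two_of_lintegral_lt_top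
    (continuous_divg (smoothField_grad hu)).stronglyMeasurable.aestronglyMeasurable
    (lt_of_le_of_lt ?_ (ENNReal.mul_lt_top (ENNReal.natCast_lt_top n) h))
  rw [h2NormSq, ← lintegral_const_mul' _ _ (ENNReal.natCast_ne_top n)]
  refine lintegral_mono fun x ↦ ?_
  rw [Real.enorm_eq_ofReal_abs, ← ENNReal.ofReal_pow (abs_nonneg _), sq_abs,
    ← ENNReal.ofReal_natCast, ← ENNReal.ofReal_mul (Nat.cast_nonneg n)]
  refine ENNReal.ofReal_le_ofReal ((laplacian_sq_le u x).trans ?_)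
  refine mul_le_mul_of_nonneg_left ?_ (Nat.cast_nonneg n)
  linarith [sq_nonneg (u x), sq_nonneg ‖grad n u x‖]

theorem memLp_ip_grad {X : Π x : M, TangentSpace (𝓡 n) x} (hX : SmoothField X) {C : ℝ}
    (hC : ∀ x, ‖X x‖ ≤ C) {u : M → ℝ} (hu : ContMDiff (𝓡 n) 𝓘(ℝ, ℝ) ∞ u) (h : h2NormSq n u < ⊤) :
    MemLp (fun x ↦ inner ℝ (grad n u x) (X x)) 2 (riemVolume n M) := by
  refine (memLp_norm_grad hu h).of_le_mul (c := C)
    ((smoothField_grad hu).contMDiff_ip hX).continuous.stronglyMeasurable.aestronglyMeasurable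
    (ae_of_all _ fun x ↦ ?_)
  refine (norm_inner_le_norm _ _).trans ?_
  rw [norm_norm, mul_comm]
  exact mul_le_mul_of_nonneg_right (hC x) (norm_nonneg _)

/-- The divergence theorem, applied to `energyField u v X`. This field is integrable because `X` is
bounded and `∇u`, `∇v` are in `L²`. -/
theorem integral_laplacian_mul_inner_grad [CompleteSpace M] {X : Π x : M, TangentSpace (𝓡 n) x}
    (hX : IsKilling X) {C : ℝ} (hC : ∀ x, ‖X x‖ ≤ C) {u v : M → ℝ}
    (hu : ContMDiff (𝓡 n) 𝓘(ℝ, ℝ) ∞ u) (hv : ContMDiff (𝓡 n) 𝓘(ℝ, ℝ) ∞ v)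
    (hu' : h2NormSq n u < ⊤) (hv' : h2NormSq n v < ⊤) :
    (∫ x, laplacian n u x * inner ℝ (grad n v x) (X x) ∂(riemVolume n M)) +
      ∫ x, laplacian n v x * inner ℝ (grad n u x) (X x) ∂(riemVolume n M) = 0 := by
  have i1 : Integrable (fun x ↦ laplacian n u x * inner ℝ (grad n v x) (X x)) (riemVolume n M) :=
    (memLp_laplacian hu hu').integrable_mul (memLp_ip_grad hX.1 hC hv hv')
  have i2 : Integrable (fun x ↦ laplacian n v x * inner ℝ (grad n u x) (X x)) (riemVolume n M) :=
    (memLp_laplacian hv hv').integrable_mul (memLp_ip_grad hX.1 hC hu hu')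
  have hd := divg_energyField hu hv hX
  rw [← integral_add i1 i2]
  simp only [← hd]
  have hW := smoothField_energyField hu hv hX.1
  refine integral_divg_eq_zero hW ?_ ((i1.add i2).congr (ae_of_all _ fun x ↦ (hd x).symm))
  have i3 : Integrable (fun x ↦ ‖grad n u x‖ * ‖grad n v x‖) (riemVolume n M) :=
    (memLp_norm_grad hu hu').integrable_mul (memLp_norm_grad hv hv')
  refine (i3.const_mul (3 * C)).mono'
    (hW.continuous_norm).stronglyMeasurable.aestronglyMeasurable (ae_of_all _ fun x ↦ ?_)
  rw [norm_norm]
  refine (norm_energyField_le u v X x).trans ?_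
  rw [mul_assoc]
  gcongr
  exact hC x

theorem aestronglyMeasurable_inner {V X : Π x : M, TangentSpace (𝓡 n) x}
    (hV : AEStronglyMeasurable (fun x ↦ (⟨x, V x⟩ : TangentBundle (𝓡 n) M)) (riemVolume n M))
    (hX : SmoothField X) :
    AEStronglyMeasurable (fun x ↦ (inner ℝ (V x) (X x) : ℝ)) (riemVolume n M) := by
  have hc : ContMDiff (𝓡 n).tangent 𝓘(ℝ, ℝ) ∞
      fun p : TangentBundle (𝓡 n) M ↦ (inner ℝ p.2 (X p.1) : ℝ) :=
    ContMDiff.inner_bundle (F := EuclideanSpace ℝ (Fin n)) (IB := 𝓡 n)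
      (b := fun p : TangentBundle (𝓡 n) M ↦ p.1) contMDiff_id
      (hX.comp (Bundle.contMDiff_proj (TangentSpace (𝓡 n))))
  exact hc.continuous.comp_aestronglyMeasurable hV

/-- As `X` is bounded, `L²` convergence of `∇u_j` to `V` gives that of `⟨∇u_j, X⟩` to `⟨V, X⟩`. -/
theorem tendsto_lintegral_inner_sub {X V : Π x : M, TangentSpace (𝓡 n) x} {C : ℝ}
    (hC : ∀ x, ‖X x‖ ≤ C) {u : ℕ → M → ℝ}
    (h : Tendsto (fun j ↦ ∫⁻ x, ‖grad n (u j) x - V x‖ₑ ^ 2 ∂(riemVolume n M)) atTop (𝓝 0)) :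
    Tendsto (fun j ↦ ∫⁻ x, ‖(inner ℝ (grad n (u j) x) (X x) - inner ℝ (V x) (X x) : ℝ)‖ₑ ^ 2
      ∂(riemVolume n M)) atTop (𝓝 0) := by
  have h1 := ENNReal.Tendsto.const_mul (a := ENNReal.ofReal C ^ 2) h (Or.inr (by simp))
  rw [mul_zero] at h1
  refine tendsto_of_tendsto_of_tendsto_of_le_of_le tendsto_const_nhds h1 (fun _ ↦ zero_le)
    fun j ↦ ?_
  show _ ≤ ENNReal.ofReal C ^ 2 * _
  rw [← lintegral_const_mul' _ _ (by simp)]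
  refine lintegral_mono fun x ↦ ?_
  rw [← mul_pow, ← inner_sub_left]
  gcongr
  rw [← ofReal_norm, ← ofReal_norm, mul_comm, ← ENNReal.ofReal_mul (norm_nonneg _)]
  refine ENNReal.ofReal_le_ofReal ((norm_inner_le_norm _ _).trans ?_)
  exact mul_le_mul_of_nonneg_left (hC x) (norm_nonneg _)

end Sobolev

end RiemCalc

end

/-- Here `V₁ = ∇f`, `L₁ = Δf` and `V₂ = ∇g`, `L₂ = Δg` in the sense of `H²(M)`. -/
theorem lemma2p1 {n : ℕ} {M : Type*} [EMetricSpace M] [CompleteSpace M]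
    [SecondCountableTopology M] [MeasurableSpace M] [BorelSpace M]
    [ChartedSpace (EuclideanSpace ℝ (Fin n)) M] [IsManifold (𝓡 n) ∞ M]
    [RiemannianBundle (fun x : M ↦ TangentSpace (𝓡 n) x)]
    [IsContMDiffRiemannianBundle (𝓡 n) ∞ (EuclideanSpace ℝ (Fin n))
      (fun x : M ↦ TangentSpace (𝓡 n) x)]
    [IsRiemannianManifold (𝓡 n) M]
    (X : Π x : M, TangentSpace (𝓡 n) x) (hX : RiemCalc.IsKilling X)
    (hbdd : ∃ C : ℝ, ∀ x : M, ‖X x‖ ≤ C)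
    (f g : M → ℝ) (V₁ V₂ : Π x : M, TangentSpace (𝓡 n) x) (L₁ L₂ : M → ℝ)
    (hf : RiemCalc.IsSobolevH2 f V₁ L₁) (hg : RiemCalc.IsSobolevH2 g V₂ L₂) :
    Integrable (fun x : M ↦ L₁ x * inner ℝ (V₂ x) (X x) + L₂ x * inner ℝ (V₁ x) (X x))
        (RiemCalc.riemVolume n M) ∧
      ∫ x : M, (L₁ x * inner ℝ (V₂ x) (X x) + L₂ x * inner ℝ (V₁ x) (X x))
        ∂(RiemCalc.riemVolume n M) = 0 := by
  obtain ⟨C, hC⟩ := hbdd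
  obtain ⟨u, hus, hu, -, -, huV, huL⟩ := hf.exists_approx
  obtain ⟨v, hvs, hv, -, -, hvV, hvL⟩ := hg.exists_approx
  have a1 := fun j ↦ RiemCalc.memLp_laplacian (hus j) (hu j)
  have a2 := fun j ↦ RiemCalc.memLp_laplacian (hvs j) (hv j)
  have b1 := fun j ↦ RiemCalc.memLp_ip_grad hX.1 hC (hus j) (hu j)
  have b2 := fun j ↦ RiemCalc.memLp_ip_grad hX.1 hC (hvs j) (hv j)
  have c1 := RiemCalc.tendsto_lintegral_inner_sub hC huV
  have c2 := RiemCalc.tendsto_lintegral_inner_sub hC hvV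
  have A1 := RiemCalc.memLp_two_of_tendsto a1 hf.aestronglyMeasurable_laplacian huL
  have A2 := RiemCalc.memLp_two_of_tendsto a2 hg.aestronglyMeasurable_laplacian hvL
  have B1 := RiemCalc.memLp_two_of_tendsto b1
    (RiemCalc.aestronglyMeasurable_inner hf.aestronglyMeasurable_grad hX.1) c1
  have B2 := RiemCalc.memLp_two_of_tendsto b2
    (RiemCalc.aestronglyMeasurable_inner hg.aestronglyMeasurable_grad hX.1) c2
  have i1 : Integrable (fun x ↦ L₁ x * inner ℝ (V₂ x) (X x)) (RiemCalc.riemVolume n M) :=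
    A1.integrable_mul B2
  have i2 : Integrable (fun x ↦ L₂ x * inner ℝ (V₁ x) (X x)) (RiemCalc.riemVolume n M) :=
    A2.integrable_mul B1
  refine ⟨i1.add i2, ?_⟩
  rw [integral_add i1 i2]
  have hlim := (RiemCalc.tendsto_integral_mul a1 b2 A1 B2 huL c2).add
    (RiemCalc.tendsto_integral_mul a2 b1 A2 B1 hvL c1)
  simp only [fun j ↦ RiemCalc.integral_laplacian_mul_inner_grad hX hC (hus j) (hvs j) (hu j) (hv j)]
    at hlim
  exact tendsto_nhds_unique hlim tendsto_const_nhds
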